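/- **Definitions.** Let $G$ be a Polish group acting continuously on a Polish space $X$. For an open neighborhood $V$ of $1_G$ and a countable ordinal $\alpha$, define binary relations $\leftrightsquigarrow^{\alpha}_V$ on $X$ by recursion on $\alpha$: 1. $x \leftrightsquigarrow^{0}_V y$ if and only if $x\in\overline{V\cdot y}$ and $y\in\overline{V\cdot x}$; 2. for $\alpha>0$, $x \leftrightsquigarrow^{\alpha}_V y$ if and only if for every open neighborhood $W$ of $1_G$ and every open $U\subseteq X$ with $x\in U$ or $y\in U$, there exist $g^x,g^y\in V$ with $g^x x\in U$ and $g^y y\in U$ such that $g^x x \leftrightsquigarrow^{\beta}_W g^y y$ for every $\beta<\alpha$. For $\alpha>0$, the action $G\curvearrowright X$ is *generically $\alpha$-unbalanced* if for every comeager $C\subseteq X$ there is a comeager $D\subseteq C$ such that for all $x,y\in D$ there is a finite sequence $x_0,\dots,x_n\in C$ with $x_0=x$, $x_n=y$ and $x_i\leftrightsquigarrow^{\beta}_G x_{i+1}$ for all $i<n$ and all $\beta<\alpha$. The action *has meager orbits* if every orbit is a meager subset of $X$. For an ordinal $0<\alpha<\omega_1$, let $\mathbb{Z}[\alpha]$ be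 the set of all maps $a\colon\alpha\to\mathbb{Z}$ with $a(\beta)=0$ for all but finitely many $\beta<\alpha$, linearly ordered by: $a<^* b$ if and only if $a\neq b$ and $a(\beta)<b(\beta)$ for the largest $\beta<\alpha$ with $a(\beta)\neq b(\beta)$. Its group $\mathrm{Aut}(\mathbb{Z}[\alpha])$ of order automorphisms carries the topology of pointwise convergence ($\mathbb{Z}[\alpha]$ being discrete), and its *Bernoulli shift* is the action on $\{0,1\}^{\mathbb{Z}[\alpha]}$ (with the product topology) given by $(g\cdot x)(a)=x(g^{-1}(a))$. **Theorem.** For every ordinal $\alpha$ with $0<\alpha<\omega_1$, the Bernoulli shift $\mathrm{Aut}(\mathbb{Z}[\alpha])\curvearrowright\{0,1\}^{\mathbb{Z}[\alpha]}$ is generically $\alpha$-unbalanced and has meager orbits. -/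

import Mathlib

open Set Topology
open scoped Ordinal

section Dynamics

variable {G X : Type*} [Group G] [TopologicalSpace G] [TopologicalSpace X] [MulAction G X]

/-- The relation `x ↭^α_V y` attached to an action of `G` on `X` and a set `V` of group elements
(an open neighbourhood of the identity in the intended use), by recursion on the ordinal `α`.

* For `α = 0`: `x` is in the closure of `V • y` and `y` is in the closure of `V • x`.
* For `α > 0`: for every open neighbourhood `W` of `1` and every open `U` with `x ∈ U` or `y ∈ U`
  there are `g, h ∈ V` with `g • x, h • y ∈ U` and `g • x ↭^β_W h • y` for all `β < α`. -/
def Squiggle (V : Set G) (α : Ordinal.{0}) (x y : X) : Prop :=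
  (α = 0 → x ∈ closure ((fun g : G => g • y) '' V) ∧ y ∈ closure ((fun g : G => g • x) '' V)) ∧
  (α ≠ 0 → ∀ W : Set G, IsOpen W → (1 : G) ∈ W → ∀ U : Set X, IsOpen U → (x ∈ U ∨ y ∈ U) →
    ∃ g ∈ V, ∃ h ∈ V, g • x ∈ U ∧ h • y ∈ U ∧
      ∀ β : Ordinal.{0}, β < α → Squiggle W β (g • x) (h • y))
termination_by α

variable (G X) in
/-- The action of `G` on `X` is generically `α`-unbalanced (for `α > 0`): every comeager `C`
contains a comeager `D` any two points of which are joined by a finite path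
`p 0, …, p n` in `C` whose consecutive terms satisfy `↭^β_G` for all `β < α`. -/
def GenericallyUnbalanced (α : Ordinal.{0}) : Prop :=
  ∀ C : Set X, C ∈ residual X → ∃ D : Set X, D ∈ residual X ∧ D ⊆ C ∧
    ∀ x ∈ D, ∀ y ∈ D, ∃ (n : ℕ) (p : Fin (n + 1) → X),
      (∀ i, p i ∈ C) ∧ p 0 = x ∧ p (Fin.last n) = y ∧
      ∀ i : Fin n, ∀ β : Ordinal.{0}, β < α →
        Squiggle (univ : Set G) β (p i.castSucc) (p i.succ)

variable (G X) in
/-- Every orbit of the action is a meager set. -/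
def HasMeagerOrbits : Prop :=
  ∀ x : X, IsMeagre (MulAction.orbit G x)

end Dynamics

section BernoulliShift

variable {L : Type*} [LinearOrder L]

/-- The automorphism group of a linear order carries the topology of pointwise convergence,
the set `L` being discrete. -/
instance OrderAut.topologicalSpace : TopologicalSpace (L ≃o L) :=
  TopologicalSpace.induced (fun (g : L ≃o L) (a : L) => g a)
    (@Pi.topologicalSpace L (fun _ => L) (fun _ => ⊥))

/-- The Bernoulli shift of `Aut(L)` on `{0,1}^L`: `(g • x)(a) = x (g⁻¹ a)`. The space `L → Bool`
carries the product topology, `Bool` being discrete. -/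
instance OrderAut.bernoulliShift : MulAction (L ≃o L) (L → Bool) where
  smul g x := fun a => x (g⁻¹ a)
  one_smul _ := rfl
  mul_smul g h x := by
    funext a
    change x ((g * h)⁻¹ a) = x (h⁻¹ (g⁻¹ a))
    rw [mul_inv_rev]
    rfl

end BernoulliShift

/-- The linear order `ℤ[α]`: finitely supported maps `a : α → ℤ`, with `a < b` if and only if
`a β < b β` for the largest `β < α` with `a β ≠ b β`. The ordinal `α` is the set of smaller
ordinals. -/
abbrev OrdinalZPow (α : Ordinal.{0}) : Type 1 := Colex (Set.Iio α →₀ ℤ)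

/-! ### Rich sets and their formal properties -/

section Rich

variable {L L' : Type*} [LinearOrder L] [LinearOrder L']

/-! Richness is a combinatorial certificate: two generic points that agree on a `β`-rich set are
related at every level below `β` (`Rich.exists_residual_squiggle`). One automorphism moves the
finitely many relevant positions into the set, where both points look alike; by genericity the first
point can be made to look unchanged there, and the translated points agree on a set of lower rank.

So it suffices to colour ℤ[α] with finitely many colours such that the complement of each is
`α`-rich (`exists_coloring_richIn`): a generic `x` is turned into a generic `t` one colour at a
time, and Kuratowski–Ulam gives a `t` serving two points at once.

Colourings arise because ℤ[γ + μ] is the lexicographic product of ℤ[μ] and ℤ[γ], and ranks combine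
along such products (`Rich.prodLex`). For α = ω^δ two colours suffice, by induction on δ
(`twoRich_omega0_opow`): `TwoRich.mul_nat` handles finite multiples of smaller powers, and
`twoRich_limit` glues colourings along an increasing sequence of convex subgroups. Any other α > 0
is a sum of two smaller ordinals and takes a product colouring.

Orbits are meager because an automorphism is determined on an infinite chain of successors by the
image of its first element, for which there are only countably many choices. -/

/-- `A` is `β`-rich over the finite set `F` if for all `β' < β`, each finite `F' ⊇ F` can be moved
into `A` by an automorphism fixing `F` pointwise, such that the moved points avoid a prescribed
finite set `E` and the preimage of `A` is `β'`-rich over `F'`. -/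
def Rich (β : Ordinal.{0}) (F : Finset L) (A : Set L) : Prop :=
  ∀ β' : Ordinal.{0}, β' < β → ∀ F' : Finset L, F ⊆ F' → ∀ E : Finset L, ∃ h : L ≃o L,
    (∀ a ∈ F, h a = a) ∧ (∀ a ∈ F', h a ∈ A ∧ (h a = a ∨ h a ∉ E)) ∧ Rich β' F' (h ⁻¹' A)
termination_by β

lemma rich_iff {β : Ordinal.{0}} {F : Finset L} {A : Set L} : Rich β F A ↔
    ∀ β' < β, ∀ F' : Finset L, F ⊆ F' → ∀ E : Finset L, ∃ h : L ≃o L,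
    (∀ a ∈ F, h a = a) ∧ (∀ a ∈ F', h a ∈ A ∧ (h a = a ∨ h a ∉ E)) ∧ Rich β' F' (h ⁻¹' A) := by
  rw [Rich]

lemma rich_zero (F : Finset L) (A : Set L) : Rich 0 F A := by
  rw [rich_iff]
  intro β' h
  exact absurd h not_lt_zero

lemma Rich.mono_ord {β γ : Ordinal.{0}} {F : Finset L} {A : Set L} (h : Rich γ F A)
    (hβ : β ≤ γ) : Rich β F A := by
  rw [rich_iff] at h ⊢
  exact fun β' hβ' => h β' (hβ'.trans_le hβ)

lemma rich_of_forall_succ {β : Ordinal.{0}} {F : Finset L} {A : Set L}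
    (h : ∀ β' < β, Rich (β' + 1) F A) : Rich β F A := by
  rw [rich_iff]
  intro β' hβ'
  exact rich_iff.1 (h β' hβ') β' (Order.lt_add_one_iff.2 le_rfl)

lemma Rich.mono_set {β : Ordinal.{0}} {F : Finset L} {A B : Set L} (h : Rich β F A)
    (hAB : A ⊆ B) : Rich β F B := by
  induction β using WellFoundedLT.induction generalizing F A B with
  | ind β ih =>
  rw [rich_iff] at h ⊢
  intro β' hβ' F' hF' E
  obtain ⟨g, h1, h2, h3⟩ := h β' hβ' F' hF' E
  exact ⟨g, h1, fun a ha => ⟨hAB (h2 a ha).1, (h2 a ha).2⟩,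
    ih β' hβ' h3 (preimage_mono hAB)⟩

lemma Rich.mono_finset {β : Ordinal.{0}} {F F₀ : Finset L} {A : Set L} (h : Rich β F₀ A)
    (hF : F ⊆ F₀) : Rich β F A := by
  induction β using WellFoundedLT.induction generalizing F F₀ A with
  | ind β ih =>
  rw [rich_iff] at h ⊢
  intro β' hβ' F' hF' E
  obtain ⟨g, h1, h2, h3⟩ := h β' hβ' (F₀ ∪ F') Finset.subset_union_left E
  exact ⟨g, fun a ha => h1 a (hF ha), fun a ha => h2 a (Finset.mem_union_right _ ha),
    ih β' hβ' h3 Finset.subset_union_right⟩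

lemma rich_univ (β : Ordinal.{0}) (F : Finset L) : Rich β F (univ : Set L) := by
  induction β using WellFoundedLT.induction generalizing F with
  | ind β ih =>
  rw [rich_iff]
  intro β' hβ' F' hF' E
  exact ⟨OrderIso.refl L, fun a _ => rfl, fun a _ => ⟨trivial, Or.inl rfl⟩, ih β' hβ' F'⟩

lemma Rich.map {β : Ordinal.{0}} {F : Finset L} {A : Set L} (h : Rich β F A) (e : L ≃o L') :
    Rich β (F.map e.toEquiv.toEmbedding) (e.symm ⁻¹' A) := by
  induction β using WellFoundedLT.induction generalizing F A with
  | ind β ih =>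
  rw [rich_iff] at h ⊢
  intro β' hβ' F' hF' E
  obtain ⟨g, h1, h2, h3⟩ := h β' hβ' (F'.map e.symm.toEquiv.toEmbedding) (fun a ha => by
    simp only [Finset.mem_map_equiv]
    exact hF' (by simpa using ha)) (E.map e.symm.toEquiv.toEmbedding)
  refine ⟨(e.symm.trans g).trans e, fun a ha => ?_, fun a ha => ?_, ?_⟩
  · have : g (e.symm a) = e.symm a := h1 _ (by simpa [Finset.mem_map_equiv] using ha)
    simp [this]
  · obtain ⟨h4, h5⟩ := h2 (e.symm a) (by simpa using ha)
    refine ⟨by simpa using h4, ?_⟩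
    rcases h5 with h5 | h5
    · left; simp [h5]
    · right
      intro h6
      apply h5
      simpa [Finset.mem_map_equiv] using h6
  · have := ih β' hβ' h3
    have hF'' : (F'.map e.symm.toEquiv.toEmbedding).map e.toEquiv.toEmbedding = F' := by
      ext a; simp [Finset.mem_map_equiv]
    rw [hF''] at this
    convert this using 1
    ext a
    simp

lemma Rich.map_empty {β : Ordinal.{0}} {A : Set L} {B : Set L'} (h : Rich β ∅ A) (e : L ≃o L')
    (hB : ∀ a ∈ A, e a ∈ B) : Rich β ∅ B := by
  have := h.map e
  rw [Finset.map_empty] at this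
  refine this.mono_set fun b hb => ?_
  have := hB _ hb
  simpa using this

end Rich

/-! ### Richness in lexicographic products -/

section Slice

variable {U M : Type*}

/-- The slice of a finite subset of `U ×ₗ M` over `u`. -/
noncomputable def lexSlice (F : Finset (U ×ₗ M)) (u : U) : Finset M :=
  F.preimage (fun m => toLex (u, m)) (fun a _ b _ h => by simpa using h)

lemma mem_lexSlice {F : Finset (U ×ₗ M)} {u : U} {m : M} :
    m ∈ lexSlice F u ↔ toLex (u, m) ∈ F := by
  exact Finset.mem_preimage

lemma lexSlice_mono {F F' : Finset (U ×ₗ M)} (h : F ⊆ F') (u : U) :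
    lexSlice F u ⊆ lexSlice F' u := fun m hm => by
  rw [mem_lexSlice] at hm ⊢
  exact h hm

end Slice

section ProdLex

variable {U M : Type*} [LinearOrder U] [LinearOrder M]

/-- The automorphism of `U ×ₗ M` acting by `h` on the first coordinate and by `k u` on the
fibre over `u`. -/
noncomputable def OrderIso.prodLexSkew (h : U ≃o U) (k : U → M ≃o M) : U ×ₗ M ≃o U ×ₗ M :=
  StrictMono.orderIsoOfSurjective
    (fun a : U ×ₗ M => toLex (h (ofLex a).1, k (ofLex a).1 (ofLex a).2))
    (by
      intro a b hab
      rw [Prod.Lex.lt_iff] at hab ⊢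
      rcases hab with hab | ⟨hab, hab'⟩
      · left; simpa using hab
      · right; simp [hab, hab'])
    (by
      intro b
      refine ⟨toLex (h.symm (ofLex b).1, (k (h.symm (ofLex b).1)).symm (ofLex b).2), ?_⟩
      simp)

lemma OrderIso.prodLexSkew_apply (h : U ≃o U) (k : U → M ≃o M) (u : U) (m : M) :
    OrderIso.prodLexSkew h k (toLex (u, m)) = toLex (h u, k u m) := rfl

open Classical in
/-- Richness of a subset of a lexicographic product: fibres over a `σ`-rich set of the base
are `(p + σ)`-rich, all other fibres are `p`-rich. -/
theorem Rich.prodLex {σ p : Ordinal.{0}} {A : Set U} {B : U → Set M} {FU : Finset U}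
    {F : Finset (U ×ₗ M)} (hF : ∀ u m, toLex (u, m) ∈ F → u ∈ FU) (hA : Rich σ FU A)
    (hB : ∀ u ∈ A, Rich (p + σ) (lexSlice F u) (B u))
    (hB' : ∀ u ∉ A, Rich p (lexSlice F u) (B u)) :
    Rich (p + σ) F {a : U ×ₗ M | (ofLex a).2 ∈ B (ofLex a).1} := by
  induction hβ : p + σ using WellFoundedLT.induction generalizing σ p A B FU F with
  | ind β ih =>
  subst hβ
  rw [rich_iff]
  intro β' hβ' F' hF' E
  -- Ranks at least `p` are met by moving the base into `A`. Below `p` every fibre is rich enough,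
  -- so the base stays put from then on.
  rcases lt_or_ge β' p with hp | hp
  · have hall : ∀ u, Rich p (lexSlice F u) (B u) := fun u => by
      by_cases hu : u ∈ A
      · exact (hB u hu).mono_ord le_self_add
      · exact hB' u hu
    have := fun u => rich_iff.1 (hall u) β' hp (lexSlice F' u) (lexSlice_mono hF' u) (lexSlice E u)
    choose k h1 h2 h3 using this
    refine ⟨OrderIso.prodLexSkew (OrderIso.refl U) k, fun a ha => ?_, fun a ha => ?_, ?_⟩
    · obtain ⟨⟨u, m⟩, rfl⟩ := toLex.surjective a
      rw [OrderIso.prodLexSkew_apply, h1 u m (mem_lexSlice.2 ha)]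
      rfl
    · obtain ⟨⟨u, m⟩, rfl⟩ := toLex.surjective a
      rw [OrderIso.prodLexSkew_apply]
      obtain ⟨h4, h5⟩ := h2 u m (mem_lexSlice.2 ha)
      refine ⟨h4, ?_⟩
      rcases h5 with h5 | h5
      · left; rw [h5]; rfl
      · right; exact fun h6 => h5 (mem_lexSlice.2 h6)
    · have := ih β' hβ' (σ := 0) (p := β') (A := ∅) (B := fun u => k u ⁻¹' B u)
        (FU := F'.image fun a => (ofLex a).1) (F := F')
        (fun u m hum => Finset.mem_image.2 ⟨_, hum, rfl⟩) (rich_zero _ _) (by simp)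
        (fun u _ => h3 u) (add_zero _)
      exact this
  · obtain ⟨σ', rfl⟩ : ∃ σ', β' = p + σ' := ⟨β' - p, (Ordinal.add_sub_cancel_of_le hp).symm⟩
    have hσ : σ' < σ := by simpa using hβ'
    set FU' : Finset U := FU ∪ F'.image fun a => (ofLex a).1 with hFU'
    obtain ⟨h, h1, h2, h3⟩ := rich_iff.1 hA σ' hσ FU' Finset.subset_union_left
      (E.image fun a => (ofLex a).1)
    -- `h` fixes `FU` pointwise, hence permutes its complement, over which `F` has no points.
    have hslice : ∀ u, lexSlice F (h u) = lexSlice F u := fun u => by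
      by_cases hu : u ∈ FU
      · rw [h1 u hu]
      · have hu' : h u ∉ FU := fun h4 => by
          have := h1 _ h4
          have := h.injective this
          exact hu (this ▸ h4)
        ext m
        rw [mem_lexSlice, mem_lexSlice]
        exact ⟨fun h5 => absurd (hF _ _ h5) hu', fun h5 => absurd (hF _ _ h5) hu⟩
    -- Fibres sent outside `A` contain no point of `F'` and can be left alone.
    have hk : ∀ u, ∃ k : M ≃o M, (h u ∉ A → k = OrderIso.refl M) ∧ (h u ∈ A →
        (∀ m ∈ lexSlice F u, k m = m) ∧ (∀ m ∈ lexSlice F' u, k m ∈ B (h u) ∧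
          (k m = m ∨ k m ∉ lexSlice E (h u))) ∧
          Rich (p + σ') (lexSlice F' u) (k ⁻¹' B (h u))) := by
      intro u
      by_cases hu : h u ∈ A
      · have := hB _ hu
        rw [hslice] at this
        obtain ⟨k, hk⟩ := rich_iff.1 this (p + σ') hβ' (lexSlice F' u) (lexSlice_mono hF' u)
          (lexSlice E (h u))
        exact ⟨k, fun h => absurd hu h, fun _ => hk⟩
      · exact ⟨OrderIso.refl M, fun _ => rfl, fun h => absurd h hu⟩
    choose k hk1 hk2 using hk
    have hF'A : ∀ u m, toLex (u, m) ∈ F' → u ∈ FU' := fun u m hum =>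
      Finset.mem_union_right _ (Finset.mem_image.2 ⟨_, hum, rfl⟩)
    refine ⟨OrderIso.prodLexSkew h k, fun a ha => ?_, fun a ha => ?_, ?_⟩
    · obtain ⟨⟨u, m⟩, rfl⟩ := toLex.surjective a
      have hu := h2 u (hF'A _ _ (hF' ha))
      rw [OrderIso.prodLexSkew_apply, (hk2 u hu.1).1 m (mem_lexSlice.2 ha), h1 u (hF _ _ ha)]
    · obtain ⟨⟨u, m⟩, rfl⟩ := toLex.surjective a
      have hu := h2 u (hF'A _ _ ha)
      rw [OrderIso.prodLexSkew_apply]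
      obtain ⟨h4, h5⟩ := (hk2 u hu.1).2.1 m (mem_lexSlice.2 ha)
      refine ⟨h4, ?_⟩
      -- Landing in `E` forces each coordinate to be fixed separately.
      by_cases hE : toLex (h u, k u m) ∈ E
      · left
        have hu' : h u = u := hu.2.resolve_right fun h6 => h6 (Finset.mem_image.2 ⟨_, hE, rfl⟩)
        have hm : k u m = m := h5.resolve_right fun h6 => h6 (mem_lexSlice.2 hE)
        rw [hu', hm]
      · right; exact hE
    · have := ih (p + σ') hβ' (σ := σ') (p := p) (A := h ⁻¹' A) (B := fun u => k u ⁻¹' B (h u))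
        (FU := FU') (F := F') hF'A h3 (fun u hu => (hk2 u hu).2.2) (fun u hu => ?_) rfl
      · exact this
      · have hempty : lexSlice F' u = ∅ := by
          ext m
          simp only [mem_lexSlice, Finset.notMem_empty, iff_false]
          exact fun h6 => hu (h2 u (hF'A _ _ h6)).1
        rw [hempty, hk1 u hu]
        exact (hB' _ hu).mono_finset (Finset.empty_subset _)

end ProdLex

/-! ### Generic points of {0,1}^L -/

section BoolPi

variable {L : Type*}

lemma mem_nhds_boolPi {x : L → Bool} {s : Set (L → Bool)} :
    s ∈ 𝓝 x ↔ ∃ E : Finset L, {y | ∀ a ∈ E, y a = x a} ⊆ s := by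
  rw [nhds_pi, Filter.mem_pi]
  constructor
  · rintro ⟨I, hI, t, ht, hts⟩
    refine ⟨hI.toFinset, fun y hy => hts fun i hi => ?_⟩
    rw [hy i (hI.mem_toFinset.2 hi)]
    exact mem_of_mem_nhds (ht i)
  · rintro ⟨E, hE⟩
    refine ⟨E, E.finite_toSet, fun a => {x a}, fun a => by simp [nhds_discrete], ?_⟩
    exact fun y hy => hE fun a ha => hy a ha

lemma dense_boolPi {S : Set (L → Bool)}
    (h : ∀ (x : L → Bool) (E : Finset L), ∃ y ∈ S, ∀ a ∈ E, y a = x a) : Dense S := by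
  intro x
  rw [mem_closure_iff_nhds]
  intro t ht
  obtain ⟨E, hE⟩ := mem_nhds_boolPi.1 ht
  obtain ⟨y, hy, hyE⟩ := h x E
  exact ⟨y, hE hyE, hy⟩

lemma isOpen_setOf_apply_eq (a b : L) : IsOpen {x : L → Bool | x a = x b} :=
  (isOpen_discrete {p : Bool × Bool | p.1 = p.2}).preimage
    (f := fun x : L → Bool => (x a, x b)) (by fun_prop)

lemma isClosed_setOf_apply_eq_const (a : L) (c : Bool) : IsClosed {x : L → Bool | x a = c} :=
  isClosed_eq (by fun_prop) continuous_const

lemma preimage_comp_equiv_mem_residual {N : Set (L → Bool)} (hN : N ∈ residual (L → Bool))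
    (h : L ≃ L) : {x : L → Bool | (fun a => x (h a)) ∈ N} ∈ residual (L → Bool) := by
  let e : (L → Bool) ≃ₜ (L → Bool) :=
    { toFun := fun x a => x (h a)
      invFun := fun x a => x (h.symm a)
      left_inv := fun x => by simp
      right_inv := fun x => by simp
      continuous_toFun := by fun_prop
      continuous_invFun := by fun_prop }
  exact tendsto_residual_of_isOpenMap e.continuous e.isOpenMap hN

open Classical in
/-- A generic `x` agrees with one of its translates `x ∘ h` on a finite set, provided the
automorphisms `h` available move that set off any finite set, up to fixed points. -/
lemma setOf_exists_eqOn_mem_residual {F : Finset L} (h : Finset L → L ≃ L)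
    (hh : ∀ E, ∀ a ∈ F, h E a = a ∨ h E a ∉ E) :
    {x : L → Bool | ∃ E, ∀ a ∈ F, x (h E a) = x a} ∈ residual (L → Bool) := by
  apply residual_of_dense_open
  · have : {x : L → Bool | ∃ E, ∀ a ∈ F, x (h E a) = x a} =
        ⋃ E, ⋂ a ∈ F, {x | x (h E a) = x a} := by ext; simp
    rw [this]
    exact isOpen_iUnion fun E => isOpen_biInter_finset fun a _ => isOpen_setOf_apply_eq _ _
  · refine dense_boolPi fun x E => ?_
    set k := h (E ∪ F) with hk
    -- A point of `F` that `k` moves lands outside `E ∪ F`, where the value copied along `k` is the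
    -- required one.
    refine ⟨fun b => if b ∈ E ∪ F then x b else x (k.symm b), ⟨E ∪ F, fun a ha => ?_⟩,
      fun a ha => ?_⟩
    · have ha' : a ∈ E ∪ F := Finset.mem_union_right _ ha
      rcases hh (E ∪ F) a ha with h1 | h1
      · rw [h1]
      · rw [← hk] at h1 ⊢
        simp only [if_pos ha', if_neg h1, Equiv.symm_apply_apply]
    · exact if_pos (Finset.mem_union_left _ ha)

end BoolPi

lemma countable_Iio_of_lt_omega_one {β : Ordinal.{0}} (hβ : β < ω₁) : Countable (Iio β) := by
  rw [← Cardinal.mk_le_aleph0_iff, Cardinal.mk_Iio_ordinal, Cardinal.lift_le_aleph0,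
    ← Cardinal.lt_aleph_one_iff, ← Cardinal.lt_ord, Cardinal.ord_aleph]
  exact hβ

/-! ### From richness to the relations -/

section Generic

variable {L : Type*} [LinearOrder L]

lemma exists_fixing_subset {W : Set (L ≃o L)} (hW : IsOpen W) (h1 : (1 : L ≃o L) ∈ W) :
    ∃ F : Finset L, {g : L ≃o L | ∀ a ∈ F, g a = a} ⊆ W := by
  let _ : TopologicalSpace L := ⊥
  have _ : DiscreteTopology L := ⟨rfl⟩
  obtain ⟨O, hO, rfl⟩ := isOpen_induced_iff.1 hW
  have hO1 : O ∈ 𝓝 (fun a : L => (1 : L ≃o L) a) := hO.mem_nhds h1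
  rw [nhds_pi, Filter.mem_pi] at hO1
  obtain ⟨I, hI, t, ht, hts⟩ := hO1
  refine ⟨hI.toFinset, fun g hg => hts fun i hi => ?_⟩
  have : g i = i := hg i (hI.mem_toFinset.2 hi)
  simp only [this]
  exact mem_of_mem_nhds (ht i)

/-- Generic points that agree on a rich set are related. -/
theorem Rich.exists_residual_squiggle [Countable L] {β : Ordinal.{0}} (hβ : β < ω₁)
    {F : Finset L} {A : Set L} (hA : Rich β F A) :
    ∃ N ∈ residual (L → Bool), ∀ x ∈ N, ∀ z ∈ N, (∀ a ∈ A, x a = z a) → ∀ β' < β,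
      ∀ V : Set (L ≃o L), {g : L ≃o L | ∀ a ∈ F, g a = a} ⊆ V → Squiggle V β' x z := by
  classical
  induction β using WellFoundedLT.induction generalizing F A with
  | ind β ih =>
  rw [rich_iff] at hA
  have hA' := fun (β' : Iio β) (F' : {F' : Finset L // F ⊆ F'}) => hA β' β'.2 F' F'.2
  choose h h1 h2 h3 using hA'
  have hN := fun (β' : Iio β) (F' : {F' : Finset L // F ⊆ F'}) (E : Finset L) =>
    ih β' β'.2 ((show β'.1 < β from β'.2).trans hβ) (h3 β' F' E)
  choose N hN1 hN2 using hN
  have : Countable (Iio β) := countable_Iio_of_lt_omega_one hβ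
  -- The first condition feeds the induction hypothesis after translation by `h`; the second makes
  -- some translate agree with `x` on `F'`. All index sets are countable.
  set R : Set (L → Bool) :=
    (⋂ β', ⋂ F', ⋂ E, {x | (fun a => x (h β' F' E a)) ∈ N β' F' E}) ∩
      ⋂ β', ⋂ F' : {F' : Finset L // F ⊆ F'},
        {x | ∃ E, ∀ a ∈ F'.1, x (h β' F' E a) = x a} with hR
  have key : ∀ (β' : Iio β) (F₀ : Finset L), ∀ x ∈ R, ∀ z ∈ R, (∀ a ∈ A, x a = z a) →
      ∀ O : Set (L → Bool), IsOpen O → x ∈ O → ∃ g : L ≃o L, (∀ a ∈ F, g a = a) ∧ g • x ∈ O ∧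
      g • z ∈ O ∧ ∀ β'' < β'.1, ∀ V : Set (L ≃o L), {g : L ≃o L | ∀ a ∈ F₀, g a = a} ⊆ V →
        Squiggle V β'' (g • x) (g • z) ∧ Squiggle V β'' (g • z) (g • x) := by
    intro β' F₀ x hx z hz hxz O hO hxO
    obtain ⟨F₁, hF₁⟩ := mem_nhds_boolPi.1 (hO.mem_nhds hxO)
    set F' : {F' : Finset L // F ⊆ F'} := ⟨F ∪ (F₀ ∪ F₁), Finset.subset_union_left⟩ with hF'
    have hx2 := hx.2
    simp only [mem_iInter, mem_ofPred_eq] at hx2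
    obtain ⟨E, hE⟩ := hx2 β' F'
    have hx1 := hx.1
    have hz1 := hz.1
    simp only [mem_iInter, mem_ofPred_eq] at hx1 hz1
    have hsub : {g : L ≃o L | ∀ a ∈ F'.1, g a = a} ⊆ {g : L ≃o L | ∀ a ∈ F₀, g a = a} :=
      fun g hg a ha => hg a (Finset.mem_union_right _ (Finset.mem_union_left _ ha))
    have hsmul : ∀ w : L → Bool, (h β' F' E)⁻¹ • w = fun a => w (h β' F' E a) := fun w => rfl
    refine ⟨(h β' F' E)⁻¹, fun a ha => ?_, hF₁ fun a ha => ?_, hF₁ fun a ha => ?_,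
      fun β'' hβ'' V hV => ⟨?_, ?_⟩⟩
    · exact (OrderIso.symm_apply_eq _).2 (h1 β' F' E a ha).symm
    · exact hE a (Finset.mem_union_right _ (Finset.mem_union_right _ ha))
    · have ha' : a ∈ F'.1 := Finset.mem_union_right _ (Finset.mem_union_right _ ha)
      rw [hsmul]
      change z _ = _
      -- `h` sends `a` into `A`, where `z` and `x` coincide, so `z` inherits the agreement obtained
      -- for `x`.
      rw [← hxz _ (h2 β' F' E a ha').1]
      exact hE a ha'
    · rw [hsmul, hsmul]
      exact hN2 β' F' E _ (hx1 _ _ _) _ (hz1 _ _ _) (fun a ha => hxz _ ha) β'' hβ'' V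
        (hsub.trans hV)
    · rw [hsmul, hsmul]
      exact hN2 β' F' E _ (hz1 _ _ _) _ (hx1 _ _ _) (fun a ha => (hxz _ ha).symm) β'' hβ'' V
        (hsub.trans hV)
  refine ⟨R, ?_, fun x hx z hz hxz β' hβ' V hV => ?_⟩
  · refine Filter.inter_mem ?_ ?_
    · simp only [countable_iInter_mem]
      exact fun β' F' E => preimage_comp_equiv_mem_residual (hN1 β' F' E) (h β' F' E).toEquiv
    · simp only [countable_iInter_mem]
      exact fun β' F' => setOf_exists_eqOn_mem_residual (fun E => (h β' F' E).toEquiv)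
        fun E a ha => (h2 β' F' E a ha).2
  · rw [Squiggle]
    refine ⟨fun _ => ⟨?_, ?_⟩, fun _ W hW hW1 O hO hxO => ?_⟩
    · refine mem_closure_iff.2 fun O hO hxO => ?_
      obtain ⟨g, hg, -, hgz, -⟩ := key ⟨β', hβ'⟩ ∅ x hx z hz hxz O hO hxO
      exact ⟨_, hgz, mem_image_of_mem _ (hV hg)⟩
    · refine mem_closure_iff.2 fun O hO hxO => ?_
      obtain ⟨g, hg, -, hgx, -⟩ := key ⟨β', hβ'⟩ ∅ z hz x hx (fun a ha => (hxz a ha).symm) O hO hxO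
      exact ⟨_, hgx, mem_image_of_mem _ (hV hg)⟩
    · obtain ⟨F₀, hF₀⟩ := exists_fixing_subset hW hW1
      rcases hxO with hxO | hzO
      · obtain ⟨g, hg, hgx, hgz, hs⟩ := key ⟨β', hβ'⟩ F₀ x hx z hz hxz O hO hxO
        exact ⟨g, hV hg, g, hV hg, hgx, hgz, fun β'' hβ'' => (hs β'' hβ'' W hF₀).1⟩
      · obtain ⟨g, hg, hgz, hgx, hs⟩ :=
          key ⟨β', hβ'⟩ F₀ z hz x hx (fun a ha => (hxz a ha).symm) O hO hzO
        exact ⟨g, hV hg, g, hV hg, hgx, hgz, fun β'' hβ'' => (hs β'' hβ'' W hF₀).2⟩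

end Generic

/-! ### Rank one in ordered groups -/

section OrderedGroup

variable {H : Type*} [AddCommGroup H] [LinearOrder H] [IsOrderedAddMonoid H]

/-- Rank one asks for a single move and nothing of the preimage of `A`, so translations suffice. -/
lemma rich_one_of_translate {A : Set H}
    (h : ∀ F E : Finset H, ∃ v, ∀ a ∈ F, v + a ∈ A ∧ v + a ∉ E) : Rich 1 ∅ A := by
  rw [rich_iff]
  intro β' hβ' F' _ E
  obtain ⟨v, hv⟩ := h F' E
  refine ⟨OrderIso.addLeft v, by simp, fun a ha => ⟨(hv a ha).1, Or.inr (hv a ha).2⟩, ?_⟩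
  rw [Order.lt_one_iff.1 hβ']
  exact rich_zero _ _

variable [Nontrivial H]

lemma rich_one_pos : Rich 1 ∅ {a : H | 0 < a} := by
  refine rich_one_of_translate fun F E => ?_
  obtain ⟨K, hK⟩ := (F.image Neg.neg).exists_le
  obtain ⟨K', hK'⟩ := exists_gt K
  obtain ⟨M, hM⟩ := (insert 0 E).exists_le
  -- `K' + a` is positive for all `a ∈ F`, and `M` bounds 0 and `E` from above.
  refine ⟨M + K', fun a ha => ?_⟩
  have h1 : M < M + K' + a := by
    have : -a < K' := (hK _ (Finset.mem_image_of_mem _ ha)).trans_lt hK'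
    rw [add_assoc, lt_add_iff_pos_right]
    exact neg_lt_iff_pos_add.1 this
  exact ⟨(hM 0 (Finset.mem_insert_self _ _)).trans_lt h1,
    fun h2 => (hM _ (Finset.mem_insert_of_mem h2)).not_gt h1⟩

lemma rich_one_neg : Rich 1 ∅ {a : H | a < 0} := by
  refine rich_one_of_translate fun F E => ?_
  obtain ⟨K, hK⟩ : ∃ K, ∀ i ∈ F.image Neg.neg, K ≤ i := (F.image Neg.neg).finite_toSet.bddBelow
  obtain ⟨K', hK'⟩ := exists_lt K
  obtain ⟨M, hM⟩ : ∃ M, ∀ i ∈ insert 0 E, M ≤ i := (insert 0 E).finite_toSet.bddBelow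
  refine ⟨M + K', fun a ha => ?_⟩
  have h1 : M + K' + a < M := by
    have : K' < -a := hK'.trans_le (hK _ (Finset.mem_image_of_mem _ ha))
    rw [add_assoc, add_lt_iff_neg_left]
    exact lt_neg_iff_add_neg.1 this
  exact ⟨h1.trans_le (hM 0 (Finset.mem_insert_self _ _)),
    fun h2 => (hM _ (Finset.mem_insert_of_mem h2)).not_gt h1⟩

end OrderedGroup

/-! ### The groups ℤ[γ] and their lexicographic decomposition -/

/-- Finitely supported maps from all ordinals to `ℤ`, ordered by the largest difference. -/
abbrev OrdFinsupp : Type 1 := Colex (Ordinal.{0} →₀ ℤ)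

/-- The subgroup `ℤ[γ]` of maps supported in `γ`. -/
def zPow (γ : Ordinal.{0}) : AddSubgroup OrdFinsupp where
  carrier := {a | ∀ i, γ ≤ i → ofColex a i = 0}
  zero_mem' := fun _ _ => rfl
  add_mem' {a b} ha hb := fun i hi => by
    change ofColex a i + ofColex b i = 0
    rw [ha i hi, hb i hi, add_zero]
  neg_mem' {a} ha := fun i hi => by
    change -ofColex a i = 0
    rw [ha i hi, neg_zero]

lemma zPow_mono {γ γ' : Ordinal.{0}} (h : γ ≤ γ') : zPow γ ≤ zPow γ' :=
  fun _ ha i hi => ha i (h.trans hi)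

lemma OrdFinsupp.lt_iff {a b : OrdFinsupp} :
    a < b ↔ ∃ i, (∀ j, i < j → ofColex a j = ofColex b j) ∧ ofColex a i < ofColex b i :=
  Iff.rfl

lemma OrdFinsupp.ext {a b : OrdFinsupp} (h : ∀ i, ofColex a i = ofColex b i) : a = b :=
  ofColex.injective (Finsupp.ext h)

/-- Convexity of `zPow γ`: a comparison with an outside point is decided at a coordinate `≥ γ`,
where all elements of `zPow γ` vanish. -/
lemma lt_of_lt_of_mem_of_notMem {γ : Ordinal.{0}} {a a' b : OrdFinsupp} (ha : a ∈ zPow γ)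
    (ha' : a' ∈ zPow γ) (hb : b ∉ zPow γ) (h : a < b) : a' < b := by
  obtain ⟨i, hi, hlt⟩ := OrdFinsupp.lt_iff.1 h
  have hγi : γ ≤ i := by
    by_contra hi'
    exact hb fun j hj => (hi j ((not_le.1 hi').trans_le hj)).symm.trans (ha j hj)
  refine OrdFinsupp.lt_iff.2 ⟨i, fun j hj => ?_, ?_⟩
  · rw [← hi j hj, ha' j (hγi.trans hj.le), ha j (hγi.trans hj.le)]
  · rwa [ha' i hγi, ← ha i hγi]

lemma lt_of_lt_of_notMem_of_mem {γ : Ordinal.{0}} {a a' b : OrdFinsupp} (ha : a ∈ zPow γ)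
    (ha' : a' ∈ zPow γ) (hb : b ∉ zPow γ) (h : b < a) : b < a' := by
  have hne : a' ≠ b := fun h => hb (h ▸ ha')
  by_contra hlt
  exact (lt_of_lt_of_mem_of_notMem ha' ha hb (lt_of_le_of_ne (not_lt.1 hlt) hne)).not_gt h

/-- Restriction to the coordinates below `γ`. -/
noncomputable def zTrunc (γ : Ordinal.{0}) (a : OrdFinsupp) : OrdFinsupp :=
  toColex ((ofColex a).filter (· < γ))

/-- The sum of `l` and of the shift of `u` by `γ` coordinates. -/
noncomputable def zAppend (γ : Ordinal.{0}) (l u : OrdFinsupp) : OrdFinsupp :=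
  toColex (ofColex l + (ofColex u).mapDomain (γ + ·))

/-- The coordinates from `γ` on. -/
noncomputable def zTail (γ : Ordinal.{0}) (a : OrdFinsupp) : OrdFinsupp :=
  toColex ((ofColex a).comapDomain (γ + ·) (add_right_injective γ).injOn)

section Append

variable {γ μ : Ordinal.{0}} {a l u l' u' : OrdFinsupp}

lemma zTrunc_mem : zTrunc γ a ∈ zPow γ := fun _ hi =>
  Finsupp.filter_apply_neg _ _ (not_lt.2 hi)

lemma zTrunc_eq_self (h : a ∈ zPow γ) : zTrunc γ a = a := by
  refine OrdFinsupp.ext fun i => ?_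
  by_cases hi : i < γ
  · exact Finsupp.filter_apply_pos _ _ hi
  · rw [h i (not_lt.1 hi)]
    exact Finsupp.filter_apply_neg _ _ hi

lemma zAppend_apply_add (hl : l ∈ zPow γ) (j : Ordinal.{0}) :
    ofColex (zAppend γ l u) (γ + j) = ofColex u j := by
  change ofColex l (γ + j) + (ofColex u).mapDomain (γ + ·) (γ + j) = _
  rw [hl _ le_self_add, Finsupp.mapDomain_apply (add_right_injective γ), zero_add]

lemma zAppend_apply_lt {i : Ordinal.{0}} (hi : i < γ) :
    ofColex (zAppend γ l u) i = ofColex l i := by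
  change ofColex l i + (ofColex u).mapDomain (γ + ·) i = _
  rw [Finsupp.mapDomain_of_notMem_range, add_zero]
  rintro ⟨j, rfl⟩
  exact (le_self_add.trans_lt hi).false

lemma zAppend_mem (hl : l ∈ zPow γ) (hu : u ∈ zPow μ) : zAppend γ l u ∈ zPow (γ + μ) := by
  intro i hi
  obtain ⟨j, rfl⟩ := exists_add_of_le (le_self_add.trans hi : γ ≤ i)
  rw [zAppend_apply_add hl]
  exact hu j (by simpa using hi)

lemma zTail_mem (ha : a ∈ zPow (γ + μ)) : zTail γ a ∈ zPow μ := fun i hi =>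
  ha (γ + i) (by simpa using hi)

lemma zAppend_trunc_tail : zAppend γ (zTrunc γ a) (zTail γ a) = a := by
  refine OrdFinsupp.ext fun i => ?_
  rcases lt_or_ge i γ with hi | hi
  · rw [zAppend_apply_lt hi]
    exact Finsupp.filter_apply_pos _ _ hi
  · obtain ⟨j, rfl⟩ := exists_add_of_le hi
    rw [zAppend_apply_add zTrunc_mem]
    rfl

lemma zAppend_zero : zAppend γ l 0 = l := by
  have : (ofColex (0 : OrdFinsupp)).mapDomain (γ + ·) = 0 := Finsupp.mapDomain_zero
  change toColex (ofColex l + (ofColex (0 : OrdFinsupp)).mapDomain (γ + ·)) = l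
  rw [this, add_zero]
  rfl

lemma zAppend_mem_left_iff (hl : l ∈ zPow γ) : zAppend γ l u ∈ zPow γ ↔ u = 0 := by
  constructor
  · intro h
    refine OrdFinsupp.ext fun i => ?_
    rw [← zAppend_apply_add hl, h _ le_self_add]
    rfl
  · rintro rfl
    rwa [zAppend_zero]

lemma zTrunc_zAppend {γ' : Ordinal.{0}} (h : γ' ≤ γ) :
    zTrunc γ' (zAppend γ l u) = zTrunc γ' l := by
  refine OrdFinsupp.ext fun i => ?_
  change (ofColex (zAppend γ l u)).filter (· < γ') i = (ofColex l).filter (· < γ') i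
  by_cases hi : i < γ'
  · rw [Finsupp.filter_apply_pos (· < γ') _ hi, Finsupp.filter_apply_pos (· < γ') _ hi,
      zAppend_apply_lt (hi.trans_le h)]
  · rw [Finsupp.filter_apply_neg (· < γ') _ hi, Finsupp.filter_apply_neg (· < γ') _ hi]

lemma zAppend_lt (hl : l ∈ zPow γ) (hl' : l' ∈ zPow γ) (h : u < u' ∨ u = u' ∧ l < l') :
    zAppend γ l u < zAppend γ l' u' := by
  rcases h with h | ⟨rfl, h⟩
  · obtain ⟨i, hi, hlt⟩ := OrdFinsupp.lt_iff.1 h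
    refine OrdFinsupp.lt_iff.2 ⟨γ + i, fun j hj => ?_, ?_⟩
    · obtain ⟨j, rfl⟩ := exists_add_of_le (le_self_add.trans hj.le : γ ≤ j)
      rw [zAppend_apply_add hl, zAppend_apply_add hl', hi j (by simpa using hj)]
    · rwa [zAppend_apply_add hl, zAppend_apply_add hl']
  · obtain ⟨i, hi, hlt⟩ := OrdFinsupp.lt_iff.1 h
    have hiγ : i < γ := by
      by_contra h
      rw [hl i (not_lt.1 h), hl' i (not_lt.1 h)] at hlt
      exact hlt.false
    refine OrdFinsupp.lt_iff.2 ⟨i, fun j hj => ?_, ?_⟩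
    · rcases lt_or_ge j γ with hj' | hj'
      · rw [zAppend_apply_lt hj', zAppend_apply_lt hj', hi j hj]
      · obtain ⟨j, rfl⟩ := exists_add_of_le hj'
        rw [zAppend_apply_add hl, zAppend_apply_add hl']
    · rwa [zAppend_apply_lt hiγ, zAppend_apply_lt hiγ]

variable (γ μ) in
/-- `ℤ[γ + μ]` is the lexicographic product of `ℤ[μ]` and `ℤ[γ]`. -/
noncomputable def zPowAddIso : zPow μ ×ₗ zPow γ ≃o zPow (γ + μ) :=
  StrictMono.orderIsoOfSurjective
    (fun a : zPow μ ×ₗ zPow γ => ⟨zAppend γ (ofLex a).2.1 (ofLex a).1.1,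
      zAppend_mem (ofLex a).2.2 (ofLex a).1.2⟩)
    (by
      intro a b hab
      refine zAppend_lt (ofLex a).2.2 (ofLex b).2.2 ?_
      rw [Prod.Lex.lt_iff] at hab
      rcases hab with h | ⟨h, h'⟩
      · exact Or.inl h
      · exact Or.inr ⟨congrArg Subtype.val h, h'⟩)
    (by
      intro a
      exact ⟨toLex (⟨zTail γ a.1, zTail_mem a.2⟩, ⟨zTrunc γ a.1, zTrunc_mem⟩),
        Subtype.ext zAppend_trunc_tail⟩)

instance nontrivial_zPow [NeZero μ] : Nontrivial (zPow μ) := by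
  refine ⟨⟨⟨toColex (Finsupp.single 0 1), fun i hi => ?_⟩, 0, fun h => ?_⟩⟩
  · have : (0 : Ordinal) ≠ i := ((pos_iff_ne_zero.2 (NeZero.ne μ)).trans_le hi).ne
    exact Finsupp.single_eq_of_ne this.symm
  · have h1 := DFunLike.congr_fun (congrArg (fun a : zPow μ => ofColex a.1) h) 0
    have h2 : Finsupp.single (0 : Ordinal.{0}) (1 : ℤ) 0 = 0 := h1
    simp at h2

end Append

/-! ### Richness inside ℤ[γ] -/

/-- A subset of `OrdFinsupp` is rich in `ℤ[γ]`. -/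
def RichIn (γ β : Ordinal.{0}) (F : Finset OrdFinsupp) (B : Set OrdFinsupp) : Prop :=
  Rich (L := zPow γ) β (F.preimage Subtype.val Subtype.val_injective.injOn) (Subtype.val ⁻¹' B)

section RichIn

variable {γ μ σ p β : Ordinal.{0}} {B B' : Set OrdFinsupp}

lemma richIn_empty : RichIn γ β ∅ B ↔ Rich (L := zPow γ) β ∅ (Subtype.val ⁻¹' B) := by
  rw [RichIn, Finset.preimage_empty]

lemma RichIn.congr {F : Finset OrdFinsupp} (h : RichIn γ β F B)
    (hB : ∀ a ∈ zPow γ, a ∈ B → a ∈ B') : RichIn γ β F B' :=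
  Rich.mono_set h fun a ha => hB a.1 a.2 ha

lemma richIn_add {A : Set (zPow μ)} (hA : Rich σ ∅ A)
    (h1 : ∀ u ∈ A, RichIn γ (p + σ) ∅ {l | zAppend γ l u ∈ B})
    (h2 : ∀ u ∉ A, RichIn γ p ∅ {l | zAppend γ l u ∈ B}) : RichIn (γ + μ) (p + σ) ∅ B := by
  simp only [richIn_empty] at h1 h2 ⊢
  have hs : ∀ u, lexSlice (∅ : Finset (zPow μ ×ₗ zPow γ)) u = ∅ := fun u => by
    ext; simp [mem_lexSlice]
  have := Rich.prodLex (F := (∅ : Finset (zPow μ ×ₗ zPow γ))) (FU := ∅) (by simp) hA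
    (B := fun u => Subtype.val ⁻¹' {l : OrdFinsupp | zAppend γ l u.1 ∈ B})
    (fun u hu => by rw [hs]; exact h1 u hu) (fun u hu => by rw [hs]; exact h2 u hu)
  exact this.map_empty (zPowAddIso γ μ) fun a ha => ha

/-- Enlarging `ℤ[γ]` to `ℤ[γ + μ]` keeps a set rich over a finite subset of `ℤ[γ]`, provided all
new fibres are rich. -/
lemma RichIn.extend {F : Finset OrdFinsupp} (hF : ∀ a ∈ F, a ∈ zPow γ) (h : RichIn γ β F B)
    (h1 : ∀ u : zPow μ, u ≠ 0 → RichIn γ β ∅ {l | zAppend γ l u ∈ B}) :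
    RichIn (γ + μ) β F B := by
  classical
  set F' : Finset (zPow μ ×ₗ zPow γ) :=
    (F.preimage Subtype.val Subtype.val_injective.injOn).map (zPowAddIso γ μ).symm.toEquiv.toEmbedding
    with hF'
  have hmem : ∀ u l, toLex (u, l) ∈ F' ↔ zAppend γ l u ∈ F := fun u l => by
    rw [hF', Finset.mem_map_equiv, Finset.mem_preimage]
    rfl
  have hu0 : ∀ u l, toLex (u, l) ∈ F' → u = 0 := fun u l h =>
    Subtype.ext ((zAppend_mem_left_iff l.2).1 (hF _ ((hmem u l).1 h)))
  -- With base rank 0 only the fibres contribute, and all of `F` sits in the fibre over 0.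
  have := Rich.prodLex (F := F') (FU := {0}) (σ := 0) (p := β) (A := ∅)
    (B := fun u => Subtype.val ⁻¹' {l : OrdFinsupp | zAppend γ l u.1 ∈ B})
    (fun u l h => Finset.mem_singleton.2 (hu0 u l h)) (rich_zero _ _) (by simp)
    (fun u _ => ?_)
  · have h3 := this.map (zPowAddIso γ μ)
    rw [add_zero] at h3
    unfold RichIn
    convert h3 using 1
    · ext a
      simp [hF', Finset.mem_map_equiv]
    · ext a
      obtain ⟨b, rfl⟩ := (zPowAddIso γ μ).surjective a
      simp only [mem_preimage, OrderIso.symm_apply_apply]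
      rfl
  · by_cases hu : u = 0
    · subst hu
      have hs : lexSlice F' 0 = F.preimage Subtype.val Subtype.val_injective.injOn := by
        ext l
        rw [mem_lexSlice, hmem, Finset.mem_preimage]
        exact iff_of_eq (congrArg (· ∈ F) zAppend_zero)
      rw [hs]
      refine Rich.mono_set h fun l hl => ?_
      change zAppend γ l.1 0 ∈ B
      rwa [zAppend_zero]
    · have hs : lexSlice F' u = ∅ := by
        ext l
        simp only [mem_lexSlice, Finset.notMem_empty, iff_false]
        exact fun h => hu (hu0 u l h)
      rw [hs, ← richIn_empty]
      exact h1 u hu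

lemma RichIn.lift {γ' : Ordinal.{0}} (h : RichIn γ β ∅ B) (hγ : γ ≤ γ') :
    RichIn γ' β ∅ {a | zTrunc γ a ∈ B} := by
  obtain ⟨μ, rfl⟩ := exists_add_of_le hγ
  have h' : ∀ u : zPow μ, RichIn γ β ∅ {l | zAppend γ l u ∈ {a | zTrunc γ a ∈ B}} := fun u =>
    h.congr fun a ha haB => by
      change zTrunc γ (zAppend γ a u) ∈ B
      rwa [zTrunc_zAppend le_rfl, zTrunc_eq_self ha]
  refine RichIn.extend (by simp) (h.congr fun a ha haB => ?_) fun u _ => h' u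
  change zTrunc γ a ∈ B
  rwa [zTrunc_eq_self ha]

lemma RichIn.mono_ord {F : Finset OrdFinsupp} (h : RichIn γ β F B) {β' : Ordinal.{0}}
    (hβ : β' ≤ β) : RichIn γ β' F B := Rich.mono_ord h hβ

end RichIn

lemma zTail_zAppend {γ : Ordinal.{0}} {l u : OrdFinsupp} (hl : l ∈ zPow γ) :
    zTail γ (zAppend γ l u) = u :=
  OrdFinsupp.ext fun j => zAppend_apply_add hl j

/-! ### Two-colourings and finite multiples -/

/-- There is a `p`-rich subset of `ℤ[γ]` whose complement is `q`-rich. -/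
def TwoRich (γ p q : Ordinal.{0}) : Prop :=
  ∃ B : Set OrdFinsupp, RichIn γ p ∅ B ∧ RichIn γ q ∅ Bᶜ

section TwoRich

variable {γ γ' μ σ p q p' q' : Ordinal.{0}}

lemma TwoRich.lift (h : TwoRich γ p q) (hγ : γ ≤ γ') : TwoRich γ' p q := by
  obtain ⟨B, h1, h2⟩ := h
  exact ⟨_, h1.lift hγ, h2.lift hγ⟩

lemma TwoRich.mono (h : TwoRich γ p q) (hp : p' ≤ p) (hq : q' ≤ q) : TwoRich γ p' q' := by
  obtain ⟨B, h1, h2⟩ := h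
  exact ⟨B, h1.mono_ord hp, h2.mono_ord hq⟩

lemma TwoRich.symm (h : TwoRich γ p q) : TwoRich γ q p := by
  obtain ⟨B, h1, h2⟩ := h
  exact ⟨Bᶜ, h2, by rwa [compl_compl]⟩

lemma twoRich_zero_right : TwoRich γ p 0 := ⟨univ, rich_univ _ _, rich_zero _ _⟩

lemma twoRich_one : TwoRich 1 1 1 := by
  refine ⟨{a | 0 < a}, ?_, ?_⟩ <;> rw [richIn_empty]
  · exact rich_one_pos
  · exact rich_one_neg.mono_set fun a (ha : a < 0) => (not_lt.2 ha.le : ¬ 0 < a)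

/-- The upper block selects the colouring of the lower one: `B₁` over `A`, `B₂` elsewhere. Each
colour gets its larger rank over a `σ`-rich set of fibres. -/
lemma TwoRich.add (h1 : TwoRich γ (p + σ) q) (h2 : TwoRich γ p (q + σ)) (h : TwoRich μ σ σ) :
    TwoRich (γ + μ) (p + σ) (q + σ) := by
  obtain ⟨A, hA, hA'⟩ := h
  obtain ⟨B₁, hp₁, hq₁⟩ := h1
  obtain ⟨B₂, hp₂, hq₂⟩ := h2
  rw [richIn_empty] at hA hA'
  refine ⟨{a | zTail γ a ∈ A ∧ zTrunc γ a ∈ B₁ ∨ zTail γ a ∉ A ∧ zTrunc γ a ∈ B₂},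
    richIn_add hA (fun u hu => ?_) (fun u hu => ?_),
    richIn_add hA' (fun u hu => ?_) (fun u hu => ?_)⟩
  · exact hp₁.congr fun a ha haB => Or.inl
      (by rw [zTail_zAppend ha, zTrunc_zAppend le_rfl, zTrunc_eq_self ha]; exact ⟨hu, haB⟩)
  · exact hp₂.congr fun a ha haB => Or.inr
      (by rw [zTail_zAppend ha, zTrunc_zAppend le_rfl, zTrunc_eq_self ha]; exact ⟨hu, haB⟩)
  · refine hq₂.congr fun a ha haB => ?_
    change ¬ (_ ∨ _)
    rw [zTail_zAppend ha, zTrunc_zAppend le_rfl, zTrunc_eq_self ha]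
    rintro (h | h)
    · exact hu h.1
    · exact haB h.2
  · refine hq₁.congr fun a ha haB => ?_
    change ¬ (_ ∨ _)
    rw [zTail_zAppend ha, zTrunc_zAppend le_rfl, zTrunc_eq_self ha]
    rintro (h | h)
    · exact haB h.2
    · exact hu h.1

/-- Unequal ranks drive the induction: one further block ℤ[μ] merges the colourings for `(n + 1, m)`
and `(n, m + 1)` into one for `(n + 1, m + 1)`. -/
lemma TwoRich.mul_nat (h : TwoRich μ μ μ) (n m : ℕ) :
    TwoRich (μ * ((n + m : ℕ) : Ordinal.{0})) (μ * (n : Ordinal.{0})) (μ * (m : Ordinal.{0})) := by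
  induction hk : n + m generalizing n m with
  | zero =>
    obtain ⟨rfl, rfl⟩ : n = 0 ∧ m = 0 := by omega
    simpa using twoRich_zero_right
  | succ k ih =>
    rcases n with _ | n
    · simpa using twoRich_zero_right.symm
    rcases m with _ | m
    · simpa using twoRich_zero_right
    have h1 := ih (n + 1) m (by omega)
    have h2 := ih n (m + 1) (by omega)
    simp only [Nat.cast_add, Nat.cast_one, mul_add, mul_one] at h1 h2 ⊢
    exact h1.add h2 h

end TwoRich

/-! ### Two-colourings at powers of ω -/

section Limit

open Classical in
/-- Extension by the identity of an automorphism of `ℤ[γ]` to `ℤ[γ']`. -/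
noncomputable def zPowExtend {γ γ' : Ordinal.{0}} (hγ : γ ≤ γ') (h : zPow γ ≃o zPow γ) :
    zPow γ' ≃o zPow γ' := by
  let f : (zPow γ ≃o zPow γ) → zPow γ' → zPow γ' := fun h a =>
    if ha : a.1 ∈ zPow γ then ⟨h ⟨a.1, ha⟩, zPow_mono hγ (h ⟨a.1, ha⟩).2⟩ else a
  have hinv : ∀ h, Function.RightInverse (f h.symm) (f h) := fun h a => by
    by_cases ha : a.1 ∈ zPow γ
    · simp [f, ha]
    · simp [f, ha]
  have hmono : StrictMono (f h) := fun a b hab => by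
    by_cases ha : a.1 ∈ zPow γ <;> by_cases hb : b.1 ∈ zPow γ
    · simp only [f, dif_pos ha, dif_pos hb]
      exact h.strictMono (a := ⟨a.1, ha⟩) (b := ⟨b.1, hb⟩) hab
    · simp only [f, dif_pos ha, dif_neg hb]
      exact lt_of_lt_of_mem_of_notMem ha (h ⟨a.1, ha⟩).2 hb hab
    · simp only [f, dif_neg ha, dif_pos hb]
      exact lt_of_lt_of_notMem_of_mem hb (h ⟨b.1, hb⟩).2 ha hab
    · simpa only [f, dif_neg ha, dif_neg hb] using hab
  exact hmono.orderIsoOfRightInverse _ _ (hinv h)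

lemma zPowExtend_apply_of_mem {γ γ' : Ordinal.{0}} (hγ : γ ≤ γ') (h : zPow γ ≃o zPow γ)
    {a : zPow γ'} (ha : a.1 ∈ zPow γ) : (zPowExtend hγ h a : OrdFinsupp) = h ⟨a.1, ha⟩ := by
  exact congrArg Subtype.val (dif_pos ha)

lemma zPowExtend_apply_of_notMem {γ γ' : Ordinal.{0}} (hγ : γ ≤ γ') (h : zPow γ ≃o zPow γ)
    {a : zPow γ'} (ha : a.1 ∉ zPow γ) : zPowExtend hγ h a = a := by
  exact dif_neg ha

variable {γ b : ℕ → Ordinal.{0}} {A : ℕ → Set OrdFinsupp} {T : Set OrdFinsupp}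

/-- Finite stages: `T` is `b m`-rich in `ℤ[γ (m + 1)]`. -/
lemma richIn_stage {m : ℕ} (hA : RichIn (γ m) (b m) ∅ (A m))
    (hT : ∀ a, a ∉ zPow (γ m) → a ∈ zPow (γ (m + 1)) → zTrunc (γ m) a ∈ A m → a ∈ T)
    {β : Ordinal.{0}} (hβ : β ≤ b m) {i : Ordinal.{0}} (hi : γ m + β ≤ i)
    (hi' : i ≤ γ (m + 1)) : RichIn i β ∅ T := by
  induction β using WellFoundedLT.induction generalizing i with
  | ind β ih =>
  refine rich_of_forall_succ fun β' hβ' => ?_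
  have hlt : γ m + β' < γ m + β := by simpa using hβ'
  -- Split off the coordinates from `γ m + β'` on. Over `u ≠ 0`, a 1-rich set, the fibre contains a
  -- lift of `A m`; over `u = 0` it is `T` itself, of rank `β'` by induction. The product has rank
  -- `β' + 1`.
  obtain ⟨μ, rfl⟩ := exists_add_of_le (hlt.le.trans hi)
  have hμ : NeZero μ := ⟨fun h => by
    rw [h, add_zero] at hi
    exact (hlt.trans_le hi).false⟩
  refine richIn_add (A := {u : zPow μ | u ≠ 0}) (rich_one_pos.mono_set fun u hu => ne_of_gt hu)
    (fun u hu => ?_) (fun u hu => ?_)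
  · refine ((hA.mono_ord ((Order.add_one_le_iff.2 hβ').trans hβ)).lift le_self_add).congr
      fun a ha haA => hT _ (fun h => hu ?_) (zPow_mono hi' (zAppend_mem ha u.2)) ?_
    · exact Subtype.ext ((zAppend_mem_left_iff ha).1 (zPow_mono le_self_add h))
    · rwa [zTrunc_zAppend le_self_add]
  · obtain rfl : u = 0 := not_not.1 hu
    refine (ih β' hβ' (hβ'.le.trans hβ) le_rfl (le_self_add.trans hi')).congr fun a _ haT => ?_
    change zAppend _ a 0 ∈ T
    rwa [zAppend_zero]

variable {θ : Ordinal.{0}}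

/-- Each fibre added between stages `k` and `k + 1` contains a copy of `A k`, whose rank `b k` is at
least `β`. -/
lemma RichIn.extend_stages (hγ : Monotone γ) (hb : Monotone b) (hγθ : ∀ m, γ m ≤ θ)
    (hA : ∀ m, RichIn (γ m) (b m) ∅ (A m))
    (hT : ∀ m a, a ∉ zPow (γ m) → a ∈ zPow (γ (m + 1)) → zTrunc (γ m) a ∈ A m → a ∈ T)
    {m : ℕ} {β : Ordinal.{0}} (hβ : β ≤ b m) {F : Finset OrdFinsupp} {B : Set OrdFinsupp}
    (hF : ∀ a ∈ F, a ∈ zPow (γ m)) (hB : ∀ a ∈ zPow θ, a ∉ zPow (γ m) → a ∈ T → a ∈ B)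
    (h : RichIn (γ m) β F B) {k : ℕ} (hk : m ≤ k) : RichIn (γ k) β F B := by
  induction k, hk using Nat.le_induction with
  | base => exact h
  | succ k hk ih =>
    obtain ⟨μ, hμ⟩ := exists_add_of_le (hγ k.le_succ)
    rw [Nat.succ_eq_add_one] at hμ
    rw [hμ]
    refine ih.extend (fun a ha => zPow_mono (hγ hk) (hF a ha)) fun u hu =>
      ((hA k).mono_ord (hβ.trans (hb hk))).congr fun l hl hlA => ?_
    have h1 : zAppend (γ k) l u ∈ zPow (γ (k + 1)) := by
      rw [hμ]
      exact zAppend_mem hl u.2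
    have h2 : zAppend (γ k) l u ∉ zPow (γ k) := fun h =>
      hu (Subtype.ext ((zAppend_mem_left_iff hl).1 h))
    refine hB _ (zPow_mono (hγθ _) h1) (fun h => h2 (zPow_mono (hγ hk) h)) (hT k _ h2 h1 ?_)
    rwa [zTrunc_zAppend le_rfl, zTrunc_eq_self hl]

lemma exists_forall_mem_zPow (hγ : Monotone γ) (hθ : ∀ a ∈ zPow θ, ∃ m, a ∈ zPow (γ m)) (m : ℕ)
    (F : Finset (zPow θ)) : ∃ k, m ≤ k ∧ ∀ a ∈ F, a.1 ∈ zPow (γ k) := by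
  classical
  induction F using Finset.induction_on with
  | empty => exact ⟨m, le_rfl, by simp⟩
  | insert a F _ ih =>
    obtain ⟨k, hk, hkF⟩ := ih
    obtain ⟨k', hk'⟩ := hθ a.1 a.2
    refine ⟨max k k', hk.trans (le_max_left _ _), fun c hc => ?_⟩
    rcases Finset.mem_insert.1 hc with rfl | hc
    · exact zPow_mono (hγ (le_max_right _ _)) hk'
    · exact zPow_mono (hγ (le_max_left _ _)) (hkF c hc)

/-- Passage to the union `ℤ[θ]` of the groups `ℤ[γ m]`. -/
lemma RichIn.union_stages (hγ : Monotone γ) (hb : Monotone b) (hγθ : ∀ m, γ m ≤ θ)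
    (hθ : ∀ a ∈ zPow θ, ∃ m, a ∈ zPow (γ m)) (hA : ∀ m, RichIn (γ m) (b m) ∅ (A m))
    (hT : ∀ m a, a ∉ zPow (γ m) → a ∈ zPow (γ (m + 1)) → zTrunc (γ m) a ∈ A m → a ∈ T)
    {m : ℕ} {β : Ordinal.{0}} (hβ : β ≤ b m) {F : Finset OrdFinsupp} {B : Set OrdFinsupp}
    (hF : ∀ a ∈ F, a ∈ zPow (γ m)) (hB : ∀ a ∈ zPow θ, a ∉ zPow (γ m) → a ∈ T → a ∈ B)
    (h : RichIn (γ m) β F B) : RichIn θ β F B := by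
  classical
  induction β using WellFoundedLT.induction generalizing m F B with
  | ind β ih =>
  unfold RichIn
  rw [rich_iff]
  intro β' hβ' F' hF' E
  -- By finiteness everything happens in one ℤ[γ k]; the automorphism found there is extended by the
  -- identity.
  obtain ⟨k, hmk, hk⟩ := exists_forall_mem_zPow hγ hθ m (F' ∪ E)
  have hkF : ∀ a ∈ F', a.1 ∈ zPow (γ k) := fun a ha => hk a (Finset.mem_union_left _ ha)
  have hk' := h.extend_stages hγ hb hγθ hA hT hβ hF hB hmk
  have hval : ∀ (D : Finset (zPow θ)) (a : OrdFinsupp) (ha : a ∈ zPow θ),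
      a ∈ D.map (Function.Embedding.subtype _) ↔ ⟨a, ha⟩ ∈ D := fun D a ha => by
    simp only [Finset.mem_map, Function.Embedding.subtype_apply]
    exact ⟨fun ⟨c, hc, hca⟩ => by subst hca; exact hc, fun h => ⟨_, h, rfl⟩⟩
  obtain ⟨g, h1, h2, h3⟩ := rich_iff.1 hk' β' hβ'
    ((F'.map (Function.Embedding.subtype _)).preimage Subtype.val Subtype.val_injective.injOn)
    (fun a ha => by
      rw [Finset.mem_preimage] at ha ⊢
      have haθ := zPow_mono (hγθ k) a.2
      exact (hval _ _ haθ).2 (hF' (Finset.mem_preimage.2 ha)))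
    ((E.map (Function.Embedding.subtype _)).preimage Subtype.val Subtype.val_injective.injOn)
  refine ⟨zPowExtend (hγθ k) g, fun a ha => ?_, fun a ha => ?_, ?_⟩
  · rw [Finset.mem_preimage] at ha
    have hak : a.1 ∈ zPow (γ k) := zPow_mono (hγ hmk) (hF _ ha)
    apply Subtype.ext
    rw [zPowExtend_apply_of_mem _ _ hak, h1 ⟨a.1, hak⟩ (Finset.mem_preimage.2 ha)]
  · have hak := hkF a ha
    obtain ⟨h4, h5⟩ := h2 ⟨a.1, hak⟩ (Finset.mem_preimage.2 ((hval _ _ a.2).2 ha))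
    refine ⟨?_, ?_⟩
    · rw [mem_preimage, zPowExtend_apply_of_mem _ _ hak]
      exact h4
    · rcases h5 with h5 | h5
      · left
        apply Subtype.ext
        rw [zPowExtend_apply_of_mem _ _ hak, h5]
      · right
        intro h6
        apply h5
        rw [Finset.mem_preimage, ← zPowExtend_apply_of_mem (hγθ k) g hak]
        exact (hval _ _ (Subtype.property _)).2 h6
  · set B' : Set OrdFinsupp :=
      {a | ∃ ha : a ∈ zPow θ, (zPowExtend (hγθ k) g ⟨a, ha⟩ : OrdFinsupp) ∈ B} with hB'
    have := ih β' hβ' (m := k) ((hβ'.le.trans hβ).trans (hb hmk))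
      (F := F'.map (Function.Embedding.subtype _)) (B := B') (fun a ha => ?_)
      (fun a ha hak haT => ⟨ha, ?_⟩) (Rich.mono_set h3 fun a ha => ?_)
    · unfold RichIn at this
      have hF'' : (F'.map (Function.Embedding.subtype _)).preimage Subtype.val
          Subtype.val_injective.injOn = F' := by
        ext a
        rw [Finset.mem_preimage]
        exact hval _ _ a.2
      rw [hF''] at this
      exact this.mono_set fun a ⟨_, ha⟩ => ha
    · obtain ⟨c, hc, rfl⟩ := Finset.mem_map.1 ha
      exact hkF c hc
    · rw [zPowExtend_apply_of_notMem _ _ hak]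
      exact hB a ha (fun h => hak (zPow_mono (hγ hmk) h)) haT
    · have haθ := zPow_mono (hγθ k) a.2
      refine ⟨haθ, ?_⟩
      have h4 := zPowExtend_apply_of_mem (hγθ k) g (a := ⟨a.1, haθ⟩) a.2
      exact (congrArg (· ∈ B) h4).mpr ha

lemma richIn_limit (hγ : Monotone γ) (hb : Monotone b) (hγθ : ∀ m, γ m ≤ θ)
    (hγb : ∀ m, γ m + b m ≤ γ (m + 1)) (hbθ : ∀ β < θ, ∃ m, β < b m)
    (hθ : ∀ a ∈ zPow θ, ∃ m, a ∈ zPow (γ m)) (hA : ∀ m, RichIn (γ m) (b m) ∅ (A m))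
    (hT : ∀ m a, a ∉ zPow (γ m) → a ∈ zPow (γ (m + 1)) → zTrunc (γ m) a ∈ A m → a ∈ T) :
    RichIn θ θ ∅ T := by
  refine rich_of_forall_succ fun β' hβ' => ?_
  obtain ⟨m, hm⟩ := hbθ β' hβ'
  have h := (richIn_stage (hA m) (hT m) le_rfl (hγb m) le_rfl).mono_ord
    (Order.add_one_le_iff.2 hm)
  exact h.union_stages hγ hb hγθ hθ hA hT
    ((Order.add_one_le_iff.2 hm).trans (hb m.le_succ)) (by simp) (fun _ _ _ h => h)

/-- The set that on `ℤ[γ (m + 1)] \ ℤ[γ m]` is given by `A m`. -/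
def stageUnion (γ : ℕ → Ordinal.{0}) (A : ℕ → Set OrdFinsupp) : Set OrdFinsupp :=
  {a | ∃ m, a ∉ zPow (γ m) ∧ a ∈ zPow (γ (m + 1)) ∧ zTrunc (γ m) a ∈ A m}

lemma mem_stageUnion_iff (hγ : Monotone γ) {m : ℕ} {a : OrdFinsupp} (h1 : a ∉ zPow (γ m))
    (h2 : a ∈ zPow (γ (m + 1))) : a ∈ stageUnion γ A ↔ zTrunc (γ m) a ∈ A m := by
  refine ⟨fun ⟨k, hk1, hk2, hk⟩ => ?_, fun h => ⟨m, h1, h2, h⟩⟩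
  obtain rfl : k = m := by
    rcases lt_trichotomy k m with h | h | h
    · exact absurd (zPow_mono (hγ h) hk2) h1
    · exact h
    · exact absurd (zPow_mono (hγ h) h2) hk1
  exact hk

/-- `b` is the running supremum of an enumeration of the ordinals below `θ`. Closure of `θ` under
addition leaves the room between `γ m` and `γ (m + 1)` that `richIn_stage` needs. -/
lemma exists_seq_twoRich (hω : θ < ω₁) (hθ : Ordinal.IsPrincipal (· + ·) θ) (hθ1 : 1 < θ)
    (h : ∀ β < θ, ∃ γ < θ, TwoRich γ β β) :
    ∃ γ b : ℕ → Ordinal.{0}, Monotone γ ∧ Monotone b ∧ (∀ m, γ m < θ) ∧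
      (∀ m, γ m + b m < γ (m + 1)) ∧ (∀ β < θ, ∃ m, β < b m) ∧
      ∀ m, TwoRich (γ m) (b m) (b m) := by
  have := countable_Iio_of_lt_omega_one hω
  have : Nonempty (Iio θ) := ⟨⟨1, hθ1⟩⟩
  obtain ⟨e, he⟩ := exists_surjective_nat (Iio θ)
  choose G hG hG' using h
  let b : ℕ → Iio θ := partialSups e
  let γ : ℕ → Iio θ := fun m => Nat.rec (⟨G (b 0) (b 0).2, hG _ _⟩ : Iio θ)
    (fun m g => ⟨max (g.1 + (b m).1 + 1) (G (b (m + 1)) (b (m + 1)).2),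
      max_lt (hθ (hθ g.2 (b m).2) hθ1) (hG _ _)⟩) m
  have hγb : ∀ m, (γ m).1 + (b m).1 < (γ (m + 1)).1 := fun m =>
    (Order.lt_add_one_iff.2 le_rfl).trans_le (le_max_left _ _)
  have hb : Monotone fun m => (b m).1 := fun m n h => (partialSups e).monotone h
  refine ⟨fun m => (γ m).1, fun m => (b m).1,
    monotone_nat_of_le_succ fun m => le_self_add.trans (hγb m).le, hb,
    fun m => (γ m).2, hγb, fun β hβ => ?_, fun m => ?_⟩
  · obtain ⟨m, hm⟩ := he ⟨β + 1, hθ hβ hθ1⟩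
    refine ⟨m, (Order.lt_add_one_iff.2 le_rfl).trans_le ?_⟩
    have : e m ≤ b m := le_partialSups e m
    rw [hm] at this
    exact this
  · refine (hG' (b m) (b m).2).lift ?_
    cases m with
    | zero => exact le_rfl
    | succ m => exact le_max_right _ _

lemma twoRich_limit (hω : θ < ω₁) (hθ : Ordinal.IsPrincipal (· + ·) θ) (hθ1 : 1 < θ)
    (h : ∀ β < θ, ∃ γ < θ, TwoRich γ β β) : TwoRich θ θ θ := by
  obtain ⟨γ, b, hγ, hb, hγθ, hγb, hbθ, hR⟩ := exists_seq_twoRich hω hθ hθ1 h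
  have hmem : ∀ a ∈ zPow θ, ∃ m, a ∈ zPow (γ m) := fun a ha => by
    have hi : ∀ i ∈ (ofColex a).support, ∃ m, i < γ m := fun i hi => by
      have hiθ : i < θ := by
        by_contra h
        exact Finsupp.mem_support_iff.1 hi (ha i (not_lt.1 h))
      obtain ⟨m, hm⟩ := hbθ i hiθ
      exact ⟨m + 1, hm.trans_le (le_add_self.trans (hγb m).le)⟩
    choose! f hf using hi
    obtain ⟨M, hM⟩ := ((ofColex a).support.image f).exists_le
    refine ⟨M, fun i hi => ?_⟩
    by_contra h0
    have hs := Finsupp.mem_support_iff.2 h0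
    exact ((hf i hs).trans_le (hγ (hM _ (Finset.mem_image_of_mem f hs)))).not_ge hi
  choose A hA hA' using hR
  -- On each layer the complement is given by `(A m)ᶜ`, so `richIn_limit` serves both colours.
  refine ⟨stageUnion γ A,
    richIn_limit hγ hb (fun m => (hγθ m).le) (fun m => (hγb m).le) hbθ hmem hA
      fun m a h1 h2 h3 => (mem_stageUnion_iff hγ h1 h2).2 h3,
    richIn_limit hγ hb (fun m => (hγθ m).le) (fun m => (hγb m).le) hbθ hmem hA'
      fun m a h1 h2 h3 h4 => h3 ((mem_stageUnion_iff hγ h1 h2).1 h4)⟩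

lemma twoRich_omega0_opow (δ : Ordinal.{0}) (hδ : ω ^ δ < ω₁) :
    TwoRich (ω ^ δ) (ω ^ δ) (ω ^ δ) := by
  induction δ using WellFoundedLT.induction with
  | ind δ ih =>
  rcases eq_or_ne δ 0 with rfl | hδ0
  · simpa using twoRich_one
  have hlt : ∀ δ' < δ, ω ^ δ' < ω ^ δ := fun δ' h =>
    (Ordinal.opow_lt_opow_iff_right Ordinal.one_lt_omega0).2 h
  have h1 : 1 < ω ^ δ := by simpa using hlt 0 (pos_iff_ne_zero.2 hδ0)
  refine twoRich_limit hδ (Ordinal.isPrincipal_add_omega0_opow δ) h1 fun β hβ => ?_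
  rcases Ordinal.zero_or_succ_or_isSuccLimit δ with h | ⟨δ', rfl⟩ | h
  · exact absurd h hδ0
  · have hδ' : δ' < Order.succ δ' := Order.lt_succ δ'
    rw [Ordinal.opow_succ] at hβ
    obtain ⟨n, hn, hβn⟩ := (Ordinal.lt_mul_iff_of_isSuccLimit Ordinal.isSuccLimit_omega0).1 hβ
    obtain ⟨n, rfl⟩ := Ordinal.lt_omega0.1 hn
    -- Rank `ω ^ δ' * n` for both colours costs `n + n` blocks of coordinates.
    refine ⟨ω ^ δ' * ((n + n : ℕ) : Ordinal.{0}), ?_,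
      ((ih δ' hδ' ((hlt _ hδ').trans hδ)).mul_nat n n).mono hβn.le hβn.le⟩
    exact (Ordinal.isPrincipal_add_omega0_opow _).mul_natCast_lt (hlt _ hδ') _
  · obtain ⟨δ', hδ', hβ'⟩ := (Ordinal.lt_opow_of_isSuccLimit Ordinal.omega0_ne_zero h).1 hβ
    exact ⟨ω ^ δ', hlt _ hδ', (ih δ' hδ' ((hlt _ hδ').trans hδ)).mono hβ'.le hβ'.le⟩

end Limit

/-! ### Finite colourings for all countable ordinals -/

/-- For countable `γ` there is a finite colouring of `ℤ[γ]` such that the complement of each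
colour is `γ`-rich. -/
theorem exists_coloring_richIn (γ : Ordinal.{0}) (hγ : γ < ω₁) :
    ∃ (k : ℕ) (c : OrdFinsupp → Fin k), ∀ i, RichIn γ γ ∅ {a | c a ≠ i} := by
  classical
  induction γ using WellFoundedLT.induction with
  | ind γ ih =>
  rcases eq_or_ne γ 0 with rfl | h0
  · exact ⟨1, fun _ => 0, fun i => rich_zero _ _⟩
  by_cases hp : Ordinal.IsPrincipal (· + ·) γ
  · obtain ⟨δ, rfl⟩ := (Ordinal.isPrincipal_add_iff_zero_or_omega0_opow.1 hp).resolve_left h0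
    obtain ⟨B, h1, h2⟩ := twoRich_omega0_opow δ hγ
    refine ⟨2, fun a => if a ∈ B then 0 else 1, fun i => ?_⟩
    fin_cases i
    · exact h2.congr fun a _ ha => by simpa using ha
    · exact h1.congr fun a _ ha => by simpa using ha
  · obtain ⟨γ₁, h1, γ₂, h2, rfl⟩ := Ordinal.exists_lt_add_of_not_isPrincipal_add hp
    obtain ⟨k, c, hc⟩ := ih γ₁ h1 (h1.trans hγ)
    obtain ⟨l, d, hd⟩ := ih γ₂ h2 (h2.trans hγ)
    refine ⟨l * k, fun a => finProdFinEquiv (d (zTail γ₁ a), c (zTrunc γ₁ a)), fun i => ?_⟩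
    obtain ⟨⟨i, j⟩, rfl⟩ := finProdFinEquiv.surjective i
    -- Colour `(i, j)` is avoided automatically over `u` with `d u ≠ i`; in the other fibres it
    -- suffices to avoid `j`.
    refine richIn_add (richIn_empty.1 (hd i)) (fun u hu => ?_) (fun u hu => ?_)
    · refine RichIn.congr (B := univ) (rich_univ _ _) fun a ha _ h => hu ?_
      have h3 := congrArg Prod.fst (finProdFinEquiv.injective h)
      simpa only [zTail_zAppend ha] using h3
    · refine (hc j).congr fun a ha haj h => haj ?_
      have h3 := congrArg Prod.snd (finProdFinEquiv.injective h)
      simpa only [zTrunc_zAppend le_rfl, zTrunc_eq_self ha] using h3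

/-! ### Kuratowski–Ulam and mixing of points -/

section Category

/-- The easy half of the Kuratowski–Ulam theorem. -/
theorem eventually_residual_prod {X Y : Type*} [TopologicalSpace X] [TopologicalSpace Y]
    [SecondCountableTopology Y] {R : Set (X × Y)} (hR : R ∈ residual (X × Y)) :
    ∀ᶠ x in residual X, ∀ᶠ y in residual Y, (x, y) ∈ R := by
  obtain ⟨S, hSo, hSd, hSc, hSR⟩ := mem_residual_iff.1 hR
  have hO : ∀ O ∈ S, ∀ᶠ x in residual X, Dense {y | (x, y) ∈ O} := fun O hO => by
    have hV : ∀ V ∈ TopologicalSpace.countableBasis Y, ∀ᶠ x in residual X,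
        ∃ y ∈ V, (x, y) ∈ O := fun V hV => by
      have heq : {x | ∃ y ∈ V, (x, y) ∈ O} = Prod.fst '' (O ∩ univ ×ˢ V) := by
        ext x
        constructor
        · rintro ⟨y, hy, hxy⟩
          exact ⟨(x, y), ⟨hxy, trivial, hy⟩, rfl⟩
        · rintro ⟨⟨x', y⟩, ⟨hxy, -, hy⟩, rfl⟩
          exact ⟨y, hy, hxy⟩
      have hVo := TopologicalSpace.isOpen_of_mem_countableBasis hV
      have hVn := TopologicalSpace.nonempty_of_mem_countableBasis hV
      refine residual_of_dense_open (s := {x | ∃ y ∈ V, (x, y) ∈ O}) ?_ ?_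
      · rw [heq]
        exact isOpenMap_fst _ ((hSo O hO).inter (isOpen_univ.prod hVo))
      · refine dense_iff_inter_open.2 fun W hW hWn => ?_
        obtain ⟨⟨x, y⟩, ⟨hx, hy⟩, hxy⟩ :=
          (hSd O hO).inter_open_nonempty (W ×ˢ V) (hW.prod hVo) (hWn.prod hVn)
        exact ⟨x, hx, y, hy, hxy⟩
    have := (eventually_countable_ball (TopologicalSpace.countable_countableBasis Y)).2 hV
    filter_upwards [this] with x hx
    refine (TopologicalSpace.isBasis_countableBasis Y).dense_iff.2 fun V hV _ => ?_
    obtain ⟨y, hy, hxy⟩ := hx V hV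
    exact ⟨y, hy, hxy⟩
  filter_upwards [(eventually_countable_ball hSc).2 hO] with x hx
  have : ∀ O ∈ S, ∀ᶠ y in residual Y, (x, y) ∈ O := fun O hOS =>
    residual_of_dense_open ((hSo O hOS).preimage (by fun_prop : Continuous fun y => (x, y)))
      (hx O hOS)
  filter_upwards [(eventually_countable_ball hSc).2 this] with y hy
  exact hSR (mem_sInter.2 hy)

variable {L : Type*}

open Classical in
/-- The point equal to `t` on `S` and to `x` off `S`. -/
noncomputable def boolMix (S : Set L) (x t : L → Bool) : L → Bool :=
  fun a => if a ∈ S then t a else x a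

lemma boolMix_mem_residual (S : Set L) {C : Set (L → Bool)} (hC : C ∈ residual (L → Bool)) :
    {p : (L → Bool) × (L → Bool) | boolMix S p.1 p.2 ∈ C} ∈
      residual ((L → Bool) × (L → Bool)) := by
  classical
  have hcont : Continuous fun p : (L → Bool) × (L → Bool) => boolMix S p.1 p.2 := by
    refine continuous_pi fun a => ?_
    by_cases ha : a ∈ S
    · simp only [boolMix, if_pos ha]
      fun_prop
    · simp only [boolMix, if_neg ha]
      fun_prop
  -- Swapping two points on `S` is an involution, so mixing is a coordinate of a homeomorphism and
  -- hence an open map.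
  let e : (L → Bool) × (L → Bool) ≃ₜ (L → Bool) × (L → Bool) :=
    { toFun := fun p => (boolMix S p.1 p.2, boolMix S p.2 p.1)
      invFun := fun p => (boolMix S p.1 p.2, boolMix S p.2 p.1)
      left_inv := fun p => by
        ext a <;> by_cases ha : a ∈ S <;> simp [boolMix, ha]
      right_inv := fun p => by
        ext a <;> by_cases ha : a ∈ S <;> simp [boolMix, ha]
      continuous_toFun := hcont.prodMk (hcont.comp continuous_swap)
      continuous_invFun := hcont.prodMk (hcont.comp continuous_swap) }
  have := tendsto_residual_of_isOpenMap (f := fun p => (e p).1)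
    (continuous_fst.comp e.continuous) (isOpenMap_fst.comp e.isOpenMap) hC
  exact this

end Category

/-! ### Generic unbalancedness from a colouring -/

section Assembly

variable {L : Type*} [LinearOrder L] [Countable L]

/-- If some finite colouring has all complements of colours `α`-rich, then the Bernoulli shift is
generically `α`-unbalanced: pass from `x` to a generic `t` changing one colour at a time. -/
theorem genericallyUnbalanced_of_coloring {α : Ordinal.{0}} (hα : α < ω₁) {k : ℕ}
    (c : L → Fin k) (hc : ∀ i, Rich α ∅ {a | c a ≠ i}) :
    GenericallyUnbalanced (L ≃o L) (L → Bool) α := by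
  intro C hC
  choose N hN hNs using fun i => (hc i).exists_residual_squiggle hα
  have hC' : C ∩ ⋂ i, N i ∈ residual (L → Bool) :=
    Filter.inter_mem hC (countable_iInter_mem.2 hN)
  set S : ℕ → Set L := fun j => {a | (c a : ℕ) < j} with hS
  have hP : (⋂ j, {p : (L → Bool) × (L → Bool) | boolMix (S j) p.1 p.2 ∈ C ∩ ⋂ i, N i}) ∈
      residual ((L → Bool) × (L → Bool)) :=
    countable_iInter_mem.2 fun j => boolMix_mem_residual (S j) hC'
  refine ⟨{x | ∀ᶠ t in residual (L → Bool), ∀ j, boolMix (S j) x t ∈ C ∩ ⋂ i, N i} ∩ C,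
    Filter.inter_mem ?_ hC, inter_subset_right, fun x hx y hy => ?_⟩
  · have := eventually_residual_prod hP
    simp only [mem_iInter] at this
    exact this
  have h0 : ∀ x t : L → Bool, boolMix (S 0) x t = x := fun x t => by
    funext a
    simp [boolMix, hS]
  have hk : ∀ x t : L → Bool, boolMix (S k) x t = t := fun x t => by
    funext a
    simp [boolMix, hS]
  have hstep : ∀ x t : L → Bool, (∀ j, boolMix (S j) x t ∈ C ∩ ⋂ i, N i) → ∀ j < k, ∀ β < α,
      Squiggle (univ : Set (L ≃o L)) β (boolMix (S j) x t) (boolMix (S (j + 1)) x t) ∧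
      Squiggle (univ : Set (L ≃o L)) β (boolMix (S (j + 1)) x t) (boolMix (S j) x t) := by
    intro x t ht j hj β hβ
    have hagree : ∀ a ∈ {a | c a ≠ ⟨j, hj⟩}, boolMix (S j) x t a = boolMix (S (j + 1)) x t a := by
      intro a ha
      have hne : (c a : ℕ) ≠ j := fun h => ha (Fin.ext h)
      have hiff : a ∈ S j ↔ a ∈ S (j + 1) := by
        simp only [hS, mem_ofPred_eq]
        omega
      by_cases h : a ∈ S (j + 1)
      · simp only [boolMix, if_pos h, if_pos (hiff.2 h)]
      · simp only [boolMix, if_neg h, if_neg (mt hiff.1 h)]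
    have h1 := mem_iInter.1 (ht j).2 ⟨j, hj⟩
    have h2 := mem_iInter.1 (ht (j + 1)).2 ⟨j, hj⟩
    exact ⟨hNs ⟨j, hj⟩ _ h1 _ h2 hagree β hβ univ (subset_univ _),
      hNs ⟨j, hj⟩ _ h2 _ h1 (fun a ha => (hagree a ha).symm) β hβ univ (subset_univ _)⟩
  have hx1 : ∀ᶠ t in residual (L → Bool), ∀ j, boolMix (S j) x t ∈ C ∩ ⋂ i, N i := hx.1
  have hy1 : ∀ᶠ t in residual (L → Bool), ∀ j, boolMix (S j) y t ∈ C ∩ ⋂ i, N i := hy.1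
  obtain ⟨t, htx, hty⟩ := (dense_of_mem_residual (hx1.and hy1)).nonempty
  -- From `x` to `t` in `k` steps, then from `t` back to `y`.
  refine ⟨2 * k, fun i => if (i : ℕ) ≤ k then boolMix (S i) x t else boolMix (S (2 * k - i)) y t,
    fun i => ?_, ?_, ?_, fun i β hβ => ?_⟩
  · dsimp only
    split_ifs
    · exact (htx _).1
    · exact (hty _).1
  · simp [h0]
  -- Without colours `L` is empty and the path is a single point.
  · rcases Nat.eq_zero_or_pos k with rfl | hpos
    · simp only [Fin.val_last, mul_zero, le_refl, if_true]
      exact (hk x t).trans (hk y t).symm |>.trans (h0 y t)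
    · have : ¬ 2 * k ≤ k := by omega
      simp [this, h0]
  · have hi := i.2
    simp only [Fin.val_castSucc, Fin.val_succ]
    rcases lt_trichotomy (i : ℕ) k with h | h | h
    · rw [if_pos h.le, if_pos (by omega)]
      exact (hstep x t htx i h β hβ).1
    · rw [if_pos h.le, if_neg (by omega), h, (hk x t).trans (hk y t).symm]
      obtain ⟨j, rfl⟩ : ∃ j, k = j + 1 := ⟨k - 1, by omega⟩
      have : 2 * (j + 1) - (j + 1 + 1) = j := by omega
      rw [this]
      exact (hstep y t hty j (by omega) β hβ).2
    · rw [if_neg (by omega), if_neg (by omega)]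
      have : 2 * k - i = 2 * k - (i + 1) + 1 := by omega
      rw [this]
      exact (hstep y t hty _ (by omega) β hβ).2

end Assembly

/-! ### Meager orbits -/

section MeagerOrbits

lemma isMeagre_setOf_eq_on_range {L : Type*} (s : ℕ → L) (hs : Function.Injective s)
    (w : ℕ → Bool) : IsMeagre {y : L → Bool | ∀ n, y (s n) = w n} := by
  classical
  have hclosed : IsClosed {y : L → Bool | ∀ n, y (s n) = w n} := by
    have : {y : L → Bool | ∀ n, y (s n) = w n} = ⋂ n, {y | y (s n) = w n} := by ext; simp
    rw [this]
    exact isClosed_iInter fun n => isClosed_setOf_apply_eq_const _ _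
  refine residual_of_dense_open hclosed.isOpen_compl (dense_boolPi fun x E => ?_)
  obtain ⟨n, hn⟩ : ∃ n, s n ∉ E := by
    by_contra! h
    exact (infinite_range_of_injective hs) (E.finite_toSet.subset (range_subset_iff.2 h))
  refine ⟨Function.update x (s n) (!w n), fun h => ?_, fun a ha => ?_⟩
  · have := h n
    simp at this
  · exact Function.update_of_ne (fun h : a = s n => hn (h ▸ ha)) _ _

/-- If `L` contains an infinite sequence of successive elements then the Bernoulli shift has
meager orbits. -/
theorem hasMeagerOrbits_of_covBy {L : Type*} [LinearOrder L] [Countable L] (s : L → ℕ → L)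
    (h0 : ∀ a, s a 0 = a) (hs : ∀ a n, s a n ⋖ s a (n + 1)) [Nonempty L] :
    HasMeagerOrbits (L ≃o L) (L → Bool) := by
  intro x
  obtain ⟨o⟩ := ‹Nonempty L›
  -- The index `b` stands for `g⁻¹ o`, which determines `g⁻¹` along the whole chain from `o`.
  refine IsMeagre.mono (s := ⋃ b, {y : L → Bool | ∀ n, y (s o n) = x (s b n)}) ?_
    (isMeagre_iUnion fun b : L => isMeagre_setOf_eq_on_range _
      (strictMono_nat_of_lt_succ fun n => (hs o n).lt).injective _)
  rintro _ ⟨g, rfl⟩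
  refine mem_iUnion.2 ⟨g⁻¹ o, fun n => ?_⟩
  have : ∀ n, g⁻¹ (s o n) = s (g⁻¹ o) n := fun n => by
    induction n with
    | zero => rw [h0, h0]
    | succ n ih =>
      have h1 : g⁻¹ (s o n) ⋖ g⁻¹ (s o (n + 1)) := (apply_covBy_apply_iff g⁻¹).2 (hs o n)
      rw [ih] at h1
      exact h1.unique_right (hs _ n)
  change x (g⁻¹ (s o n)) = _
  rw [this]

end MeagerOrbits

/-! ### Transfer to `OrdinalZPow` and conclusion -/

section OrdinalZPow

variable {α : Ordinal.{0}}

/-- `ℤ[α]` with exponents in the subtype `Iio α` is isomorphic to the subgroup `zPow α`. -/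
noncomputable def zPowIso (α : Ordinal.{0}) : OrdinalZPow α ≃o zPow α :=
  StrictMono.orderIsoOfSurjective
    (fun a : OrdinalZPow α => ⟨toColex ((ofColex a).embDomain (Function.Embedding.subtype _)),
      fun i hi => Finsupp.embDomain_of_notMem_range _ _ _ (by simpa using hi)⟩)
    (by
      intro a b hab
      obtain ⟨i, hi, hlt⟩ := Finsupp.Colex.lt_iff.1 hab
      refine OrdFinsupp.lt_iff.2 ⟨i.1, fun j hj => ?_, ?_⟩
      · by_cases hjα : j < α
        · have := hi ⟨j, hjα⟩ hj
          exact ((ofColex a).embDomain_apply_self (Function.Embedding.subtype _) ⟨j, hjα⟩).trans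
            (this.trans
              ((ofColex b).embDomain_apply_self (Function.Embedding.subtype _) ⟨j, hjα⟩).symm)
        · exact (Finsupp.embDomain_of_notMem_range _ _ _ (by simpa using hjα)).trans
            (Finsupp.embDomain_of_notMem_range _ _ _ (by simpa using hjα)).symm
      · have h1 := (ofColex a).embDomain_apply_self (Function.Embedding.subtype _) i
        have h2 := (ofColex b).embDomain_apply_self (Function.Embedding.subtype _) i
        exact (h1.trans_lt hlt).trans_eq h2.symm)
    (by
      intro b
      refine ⟨toColex ((ofColex b.1).subtypeDomain (· ∈ Iio α)), Subtype.ext ?_⟩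
      refine OrdFinsupp.ext fun j => ?_
      by_cases hjα : j < α
      · exact ((ofColex b.1).subtypeDomain (· ∈ Iio α)).embDomain_apply_self
          (Function.Embedding.subtype _) ⟨j, hjα⟩
      · exact (Finsupp.embDomain_of_notMem_range _ _ _ (by simpa using hjα)).trans
          (b.2 j (not_lt.1 hjα)).symm)

/-- Coordinate 0 is the least significant, so a point in between would need an integer strictly
between two consecutive ones. -/
lemma covBy_add_single_zero (h : 0 < α) (a : OrdinalZPow α) :
    a ⋖ toColex (ofColex a + Finsupp.single ⟨0, h⟩ 1) := by
  have hadd : ∀ j, ofColex (toColex (ofColex a + Finsupp.single (⟨0, h⟩ : Iio α) (1 : ℤ))) j =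
      ofColex a j + Finsupp.single (⟨0, h⟩ : Iio α) (1 : ℤ) j := fun j => rfl
  have hne : ∀ j : Iio α, (⟨0, h⟩ : Iio α) < j →
      Finsupp.single (⟨0, h⟩ : Iio α) (1 : ℤ) j = 0 := fun j hj =>
    Finsupp.single_eq_of_ne hj.ne'
  refine ⟨Finsupp.Colex.lt_iff.2 ⟨⟨0, h⟩, fun j hj => ?_, ?_⟩, fun b hab hba => ?_⟩
  · exact ((hadd j).trans (by rw [hne j hj, add_zero])).symm
  · refine lt_of_lt_of_eq ?_ (hadd _).symm
    rw [Finsupp.single_eq_same]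
    exact lt_add_one (ofColex a ⟨0, h⟩)
  · obtain ⟨i, hi, hlt⟩ := Finsupp.Colex.lt_iff.1 hab
    obtain ⟨j, hj, hlt'⟩ := Finsupp.Colex.lt_iff.1 hba
    change ofColex a i < ofColex b i at hlt
    replace hi : ∀ k, i < k → ofColex a k = ofColex b k := hi
    replace hj : ∀ k, j < k → ofColex b k =
      ofColex a k + Finsupp.single (⟨0, h⟩ : Iio α) (1 : ℤ) k := hj
    replace hlt' : ofColex b j < ofColex a j + Finsupp.single (⟨0, h⟩ : Iio α) (1 : ℤ) j := hlt'
    have h0 : ∀ k : Iio α, ⟨0, h⟩ ≤ k := fun k => (zero_le : (0 : Ordinal) ≤ k.1)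
    rcases (h0 j).eq_or_lt with rfl | hj0
    · rcases (h0 i).eq_or_lt with rfl | hi0
      · rw [Finsupp.single_eq_same] at hlt'
        omega
      · have := hj i hi0
        rw [hne i hi0] at this
        omega
    · rw [hne j hj0] at hlt'
      rcases lt_trichotomy i j with hij | rfl | hij
      · have := hi j hij
        omega
      · omega
      · have := hj i hij
        rw [hne i (hj0.trans hij)] at this
        omega

end OrdinalZPow

theorem theorem1p6 (α : Ordinal.{0}) (hα : 0 < α) (hα' : α < ω₁) :
    GenericallyUnbalanced (OrdinalZPow α ≃o OrdinalZPow α) (OrdinalZPow α → Bool) α ∧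
      HasMeagerOrbits (OrdinalZPow α ≃o OrdinalZPow α) (OrdinalZPow α → Bool) := by
  have := countable_Iio_of_lt_omega_one hα'
  have : Countable (OrdinalZPow α) := inferInstanceAs (Countable (Iio α →₀ ℤ))
  constructor
  · obtain ⟨k, c, hc⟩ := exists_coloring_richIn α hα'
    refine genericallyUnbalanced_of_coloring hα' (fun a => c (zPowIso α a)) fun i => ?_
    refine (richIn_empty.1 (hc i)).map_empty (zPowIso α).symm fun a ha => ?_
    change c (zPowIso α ((zPowIso α).symm a)) ≠ i
    rw [OrderIso.apply_symm_apply]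
    exact ha
  · exact hasMeagerOrbits_of_covBy
      (fun a n => Nat.rec a (fun _ b => toColex (ofColex b + Finsupp.single ⟨0, hα⟩ 1)) n)
      (fun _ => rfl) (fun a n => covBy_add_single_zero hα _)
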